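/- **Conventions.** A *pre-causal category* is a compact closed (symmetric) category $\mathbf C$ with unit $I$ and duals $A^*$, equipped with a discarding effect $\mathsf d_A : A \to I$ for every object, such that - (C1) $\mathsf d_{A\otimes B} = \mathsf d_A\otimes \mathsf d_B$ and $\mathsf d_I = 1_I$ (under the usual identifications $I^*=I$, $(A\otimes B)^*=A^*\otimes B^*$, $A^{**}=A$, which discarding is taken to respect). A morphism $f:A\to B$ is *causal* if $\mathsf d_B\circ f = \mathsf d_A$; the *uniform state* $u_A : I\to A$ is the transpose of $\mathsf d_{A^*}$; - (C2) the scalar $\mathsf d_A\circ u_A$ is invertible for every non-zero object $A$; - (C3) morphisms $f,g:A\to B$ that agree on all causal states of $A$ are equal; - (C4) if $\Phi : A\otimes B\to A'\otimes B'$ is causal and $(1_{A'}\otimes \mathsf d_{B'})\circ\Phi = \Phi'\otimes\mathsf d_B$ for some causal $\Phi':A\to A'$, then $\Phi = (1_{A'}\otimes\Phi_2)\circ(\Phi_1\otimes 1_B)$ for some object $Z$ and causal $\Phi_1:A\to A'\otimes Z$, $\Phi_2:Z\otimes B\to B'$; - (C5) if $w:B\to A$ satisfies $\operatorname{tr}(w\circ\Phi)=1$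 for every causal $\Phi:A\to B$, then $w=\rho\circ\mathsf d_B$ for some causal state $\rho$ of $A$. For a set $c$ of states of $A$ let $c^*$ be the set of effects $\pi$ on $A$ with $\pi\circ\rho=1$ for all $\rho\in c$, also read as a set of states of $A^*$. The category $[\mathbf C]=\mathbf{Caus}[\mathbf C]$ has as objects the pairs $(A,c_A)$ with $c_A=c_A^{**}$ that are flat (there are invertible scalars $\lambda,\mu$ with $\lambda u_A\in c_A$ and $\mu\mathsf d_A\in c_A^*$), and as morphisms $(A,c_A)\to(B,c_B)$ the morphisms $f:A\to B$ of $\mathbf C$ with $f\circ\rho\in c_B$ for all $\rho\in c_A$. It is closed symmetric monoidal with unit $(I,\{1_I\})$, $(A,c_A)\otimes(B,c_B)=(A\otimes B,(c_A\otimes c_B)^{**})$, $(A,c_A)\mathbin{\&}(B,c_B)=(A\otimes B,(c_A^*\otimes c_B^*)^*)$ and internal hom $[A,B]=A^*\mathbin{\&}B$. Given a partial order $\le$ on every hom-set of $\mathbf C$ for which $\circ$ and $\otimes$ are monotone, $[\mathbf C_\le]=\mathbf{Caus}_\le[\mathbf C]$ has the same objects, and its morphisms are the morphisms $f$ of $\mathbf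 C$ for which there is $f'\ge f$ in $[\mathbf C]$; the same formulas make it closed symmetric monoidal. For the discrete order, $[\mathbf C_=]=[\mathbf C]$. *Layers.* $[\mathbf C]^1\subseteq[\mathbf C]$ is the full subcategory of first-order objects $(A,\{\mathsf d_A\}^*)$; $[\mathbf C]^{i+1}$ is the full subcategory on the objects generated under $\otimes$ and $\&$ by the objects $[A,B]$ with $A,B\in[\mathbf C]^i$. Each is symmetric monoidal under $\otimes$, with units $I_1=I$, $I_{i+1}=[I_i,I_i]$ (canonically isomorphic to $I$). The layers $[\mathbf C_\le]^i$ of $[\mathbf C_\le]$ are defined in the same way. *Enrichment.* For a symmetric monoidal category $\mathbf V$, a $\mathbf V_{\cong}$-smc is a symmetric monoidal category $\mathbf D$ with objects $[A,B]$ of $\mathbf V$, bijections $\kappa:\mathbf D(A,B)\cong\mathbf V(I_{\mathbf V},[A,B])$, composition morphisms $\bigcirc_{ABC}:[A,B]\otimes[B,C]\to[A,C]$ and parallel composition morphisms $\otimes_{AA'BB'}:[A,A']\otimes[B,B']\to[A\otimes B,A'\otimes B']$ in $\mathbf V$, which represent $\circ$, identities and $\otimes$ of $\mathbf D$ on states,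 satisfy the unit, associativity and interchange laws, and for which the associator, unitors and braiding of $\mathbf D$ are $\mathbf V$-natural. The internal hom of $[\mathbf C]$ (resp. $[\mathbf C_\le]$) makes each layer $[\mathbf C]^i$ a $[\mathbf C]^{i+1}_{\cong}$-smc (resp. $[\mathbf C_\le]^i$ a $[\mathbf C_\le]^{i+1}_{\cong}$-smc). A *pm-functor* (a morphism of $\mathbf{PM}$) from a $\mathbf V_{\cong}$-smc $\mathbf D$ to a $\mathbf V'_{\cong}$-smc $\mathbf D'$ consists of symmetric (strong) monoidal functors $\mathcal F^V:\mathbf V\to\mathbf V'$ and $\mathcal F^D:\mathbf D\to\mathbf D'$ and morphisms $\mathcal F_{AB}:\mathcal F^V[A,B]\to[\mathcal F^DA,\mathcal F^DB]$ of $\mathbf V'$ compatible, up to the structure morphisms of $\mathcal F^V$ and $\mathcal F^D$, with the states $\kappa(f)$, with sequential composition $\bigcirc$ and with parallel composition $\otimes$. For a $\mathbf V_{\cong}$-smc $\mathbf D$ write $\mathcal R_{\mathbf D}^{\mathbf V}=[I,-]:\mathbf D\to\mathbf V$ for the raising functor, with its canonical comparison morphisms $\kappa(1_I):I_{\mathbf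 V}\to[I,I]$ and $[I,A]\otimes[I,B]\to[I\otimes I,A\otimes B]\cong[I,A\otimes B]$. *Partial insertion* is $\Delta:[A,X]\otimes[Y\otimes X,Z]\to[Y\otimes A,Z]$, obtained by tensoring the first factor with $\kappa(1_Y)$ through $\otimes_{YYAX}$ and composing with the second factor. **Statement.** Let $\mathbf C$ be a pre-causal category. For every $i\ge1$ there is a pm-functor $$\Gamma=(\mathcal R_{i+1}^{i+2},\mathcal R_i^{i+1},\gamma)$$ from the $[\mathbf C]^{i+1}_{\cong}$-smc $[\mathbf C]^i$ to the $[\mathbf C]^{i+2}_{\cong}$-smc $[\mathbf C]^{i+1}$, where $\mathcal R_{i}^{i+1}:[\mathbf C]^i\to[\mathbf C]^{i+1}$ and $\mathcal R_{i+1}^{i+2}:[\mathbf C]^{i+1}\to[\mathbf C]^{i+2}$ are the raising functors, symmetric monoidal by their canonical comparison morphisms (which are isomorphisms), and $$\gamma_{A,B}:[I,[A,B]]\to[[I,A],[I,B]]$$ is partial insertion in $[\mathbf C]^{i+2}$ applied to the composition morphism of $[\mathbf C]^{i+1}$: it inserts the state $\kappa(\bigcirc_{IAB})$ of $[[I,A]\otimes[A,B],[I,B]]$,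 applies $\Delta:[I,[A,B]]\otimes[[I,A]\otimes[A,B],[I,B]]\to[[I,A]\otimes I,[I,B]]$, and identifies $[I,A]\otimes I\cong[I,A]$. Moreover, for every partial order $\le$ on the hom-sets of $\mathbf C$ for which $\circ$ and $\otimes$ are monotone, the same holds for the layers $[\mathbf C_\le]^i$ of $[\mathbf C_\le]$. -/

import Mathlib

open CategoryTheory MonoidalCategory
universe v v' v₁ v₂ u u' u₁ u₂

namespace HigherOrder
set_option linter.unusedSectionVars false
set_option linter.style.longLine false

/-- A `V_≅`-symmetric monoidal category `C`, for a symmetric monoidal category `V`.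
The `V_≅`-category part is `EnrichedOrdinaryCategory V C`: objects `A ⟶[V] B` of `V`, compositions
`eComp : (A ⟶[V] B) ⊗ (B ⟶[V] D) ⟶ (A ⟶[V] D)`, bijections `κ = eHomEquiv V` from `A ⟶ B` to
`𝟙_ V ⟶ (A ⟶[V] B)` compatible with identities and composition, with associativity and unit laws
(the hom functor and the naturality of `κ` and of composition follow from these data).
The symmetric pseudomonoid structure is the symmetric monoidal structure of `C`, parallel
composition morphisms `eTensor` representing it on states and functorial for composition, and the
`V`-naturality of the associator, the unitors and the braiding. -/
class EnrichedSMC (V : Type u') [Category.{v'} V] [MonoidalCategory V] [SymmetricCategory V]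
    (C : Type u) [Category.{v} C] [MonoidalCategory C] [SymmetricCategory C]
    extends EnrichedOrdinaryCategory V C where
  eTensor (A A' B B' : C) : (A ⟶[V] A') ⊗ (B ⟶[V] B') ⟶ ((A ⊗ B : C) ⟶[V] (A' ⊗ B' : C))
  eHomEquiv_tensor {A A' B B' : C} (f : A ⟶ A') (g : B ⟶ B') :
    eHomEquiv V (f ⊗ₘ g) =
      (λ_ (𝟙_ V)).inv ≫ (eHomEquiv V f ⊗ₘ eHomEquiv V g) ≫ eTensor A A' B B'
  eTensor_comp (A A' A'' B B' B'' : C) :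
    tensorμ (A ⟶[V] A') (A' ⟶[V] A'') (B ⟶[V] B') (B' ⟶[V] B'') ≫
        (eTensor A A' B B' ⊗ₘ eTensor A' A'' B' B'') ≫
          eComp V (A ⊗ B) (A' ⊗ B') (A'' ⊗ B'') =
      (eComp V A A' A'' ⊗ₘ eComp V B B' B'') ≫ eTensor A A'' B B''
  associator_eNatural (A A' B B' D D' : C) :
    eTensor A A' B B' ▷ (D ⟶[V] D') ≫ eTensor (A ⊗ B) (A' ⊗ B') D D' ≫
        eHomWhiskerLeft V ((A ⊗ B) ⊗ D) (α_ A' B' D').hom =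
      (α_ (A ⟶[V] A') (B ⟶[V] B') (D ⟶[V] D')).hom ≫
        (A ⟶[V] A') ◁ eTensor B B' D D' ≫ eTensor A A' (B ⊗ D) (B' ⊗ D') ≫
          eHomWhiskerRight V (α_ A B D).hom (A' ⊗ B' ⊗ D')
  leftUnitor_eNatural (A A' : C) :
    eId V (𝟙_ C) ▷ (A ⟶[V] A') ≫ eTensor (𝟙_ C) (𝟙_ C) A A' ≫
        eHomWhiskerLeft V (𝟙_ C ⊗ A) (λ_ A').hom =
      (λ_ (A ⟶[V] A')).hom ≫ eHomWhiskerRight V (λ_ A).hom A'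
  rightUnitor_eNatural (A A' : C) :
    (A ⟶[V] A') ◁ eId V (𝟙_ C) ≫ eTensor A A' (𝟙_ C) (𝟙_ C) ≫
        eHomWhiskerLeft V (A ⊗ 𝟙_ C) (ρ_ A').hom =
      (ρ_ (A ⟶[V] A')).hom ≫ eHomWhiskerRight V (ρ_ A).hom A'
  braiding_eNatural (A A' B B' : C) :
    eTensor A A' B B' ≫ eHomWhiskerLeft V (A ⊗ B) (β_ A' B').hom =
      (β_ (A ⟶[V] A') (B ⟶[V] B')).hom ≫ eTensor B B' A A' ≫
        eHomWhiskerRight V (β_ A B).hom (B' ⊗ A')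


section PM
open Functor.LaxMonoidal

section
variable (V : Type u') [Category.{v'} V] [MonoidalCategory V] [SymmetricCategory V]
  (C : Type u) [Category.{v} C] [MonoidalCategory C] [SymmetricCategory C] [EnrichedSMC V C]

/-- The raising functor `[I, -] : C ⥤ V`. -/
abbrev raise : C ⥤ V := (eHomFunctor V C).obj (Opposite.op (𝟙_ C))

/-- The canonical unit comparison `κ (𝟙 I) : I ⟶ [I, I]` of the raising functor. -/
def raiseUnit : 𝟙_ V ⟶ (raise V C).obj (𝟙_ C) := eHomEquiv V (𝟙 (𝟙_ C))

/-- The canonical tensor comparison `[I, A] ⊗ [I, B] ⟶ [I ⊗ I, A ⊗ B] ≅ [I, A ⊗ B]` of the raising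
functor. -/
def raiseTensor (A B : C) :
    (raise V C).obj A ⊗ (raise V C).obj B ⟶ (raise V C).obj (A ⊗ B) :=
  EnrichedSMC.eTensor (𝟙_ C) A (𝟙_ C) B ≫ eHomWhiskerRight V (λ_ (𝟙_ C)).inv (A ⊗ B)

variable {C} in
/-- Partial insertion `Δ : [A, X] ⊗ [Y ⊗ X, Z] ⟶ [Y ⊗ A, Z]`: tensor the first argument with the
identity of `Y`, then compose with the second argument. -/
def partialInsertion (A X Y Z : C) :
    (A ⟶[V] X) ⊗ ((Y ⊗ X : C) ⟶[V] Z) ⟶ ((Y ⊗ A : C) ⟶[V] Z) :=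
  ((λ_ (A ⟶[V] X)).inv ≫ eHomEquiv V (𝟙 Y) ▷ (A ⟶[V] X) ≫ EnrichedSMC.eTensor Y Y A X) ▷
      ((Y ⊗ X : C) ⟶[V] Z) ≫
    eComp V (Y ⊗ A) (Y ⊗ X) Z

end

section
variable (W : Type u₁) [Category.{v₁} W] [MonoidalCategory W] [SymmetricCategory W]
  (V : Type u') [Category.{v'} V] [MonoidalCategory V] [SymmetricCategory V] [EnrichedSMC W V]
  {C : Type u} [Category.{v} C] [MonoidalCategory C] [SymmetricCategory C] [EnrichedSMC V C]

/-- Partial insertion in `W` applied to the composition morphism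
`[I, A] ⊗ [A, B] ⟶ [I, B]` of `V`, up to unitors:
`[I, [A, B]] ⟶ [I, [A, B]] ⊗ [[I, A] ⊗ [A, B], [I, B]] ⟶ [[I, A] ⊗ I, [I, B]] ≅ [[I, A], [I, B]]`,
where the first map inserts the state `κ (eComp)`. -/
def gamma (A B : C) :
    (raise W V).obj (A ⟶[V] B) ⟶ ((raise V C).obj A ⟶[W] (raise V C).obj B) :=
  (ρ_ _).inv ≫ (𝟙_ V ⟶[W] (A ⟶[V] B)) ◁ eHomEquiv W (eComp V (𝟙_ C) A B) ≫
    partialInsertion W (𝟙_ V) (A ⟶[V] B) (𝟙_ C ⟶[V] A) (𝟙_ C ⟶[V] B) ≫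
      eHomWhiskerRight W (ρ_ (𝟙_ C ⟶[V] A)).inv (𝟙_ C ⟶[V] B)

end

/-- A pm-functor from the `V_≅`-smc `C` to the `V'_≅`-smc `C'` whose two underlying functors are `FV`
and `FC`: symmetric (strong) monoidal structures on `FV` and `FC` and morphisms
`FV [A, B] ⟶ [FC A, FC B]` of `V'` compatible with states, with sequential composition and with
parallel composition (naturality in `A` and `B` follows from the first two). -/
structure PMFunctor
    {V : Type u'} [Category.{v'} V] [MonoidalCategory V] [SymmetricCategory V]
    {C : Type u} [Category.{v} C] [MonoidalCategory C] [SymmetricCategory C] [EnrichedSMC V C]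
    {V' : Type u₂} [Category.{v₂} V'] [MonoidalCategory V'] [SymmetricCategory V']
    {C' : Type u₁} [Category.{v₁} C'] [MonoidalCategory C'] [SymmetricCategory C']
    [EnrichedSMC V' C'] (FV : V ⥤ V') (FC : C ⥤ C') where
  braidedV : FV.Braided
  braidedC : FC.Braided
  map (A B : C) : FV.obj (A ⟶[V] B) ⟶ (FC.obj A ⟶[V'] FC.obj B)
  map_state {A B : C} (f : A ⟶ B) :
    eHomEquiv V' (FC.map f) = ε FV ≫ FV.map (eHomEquiv V f) ≫ map A B
  map_comp (A B E : C) :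
    μ FV (A ⟶[V] B) (B ⟶[V] E) ≫ FV.map (eComp V A B E) ≫ map A E =
      (map A B ⊗ₘ map B E) ≫ eComp V' (FC.obj A) (FC.obj B) (FC.obj E)
  map_tensor (A A' B B' : C) :
    (map A A' ⊗ₘ map B B') ≫
        EnrichedSMC.eTensor (FC.obj A) (FC.obj A') (FC.obj B) (FC.obj B') ≫
          eHomWhiskerLeft V' (FC.obj A ⊗ FC.obj B) (μ FC A' B') =
      μ FV (A ⟶[V] A') (B ⟶[V] B') ≫ FV.map (EnrichedSMC.eTensor A A' B B') ≫
        map (A ⊗ B) (A' ⊗ B') ≫ eHomWhiskerRight V' (μ FC A B) (FC.obj (A' ⊗ B'))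

/-- The monoidal structure on the raising functor is the canonical one. -/
structure IsRaising (V : Type u') [Category.{v'} V] [MonoidalCategory V] [SymmetricCategory V]
    (C : Type u) [Category.{v} C] [MonoidalCategory C] [SymmetricCategory C] [EnrichedSMC V C]
    (F : (raise V C).Braided) : Prop where
  unit_eq : ε (raise V C) = raiseUnit V C
  tensor_eq (A B : C) : μ (raise V C) A B = raiseTensor V C A B

/-- `Γ = (raise W V, raise V C, gamma)` as a pm-functor, both raising functors with their canonical
symmetric monoidal structures. -/
structure IsGamma
    {W : Type u₁} [Category.{v₁} W] [MonoidalCategory W] [SymmetricCategory W]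
    {V : Type u'} [Category.{v'} V] [MonoidalCategory V] [SymmetricCategory V] [EnrichedSMC W V]
    {C : Type u} [Category.{v} C] [MonoidalCategory C] [SymmetricCategory C] [EnrichedSMC V C]
    (Γ : PMFunctor (raise W V) (raise V C)) : Prop where
  raisingV : IsRaising W V Γ.braidedV
  raisingC : IsRaising V C Γ.braidedC
  map_eq (A B : C) : Γ.map A B = gamma W V A B

end PM

section Closed
variable {D : Type u} [Category.{v} D] [MonoidalCategory D] [SymmetricCategory D]
  [MonoidalClosed D]
open MonoidalClosed

/-- The evaluation morphism of a closed symmetric monoidal category. -/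
abbrev evl (A B : D) : A ⊗ (ihom A).obj B ⟶ B := (ihom.ev A).app B

/-- The parallel composition `[A, A'] ⊗ [B, B'] ⟶ [A ⊗ B, A' ⊗ B']` of internal homs: the transpose of
the tensor product of two evaluations. -/
def tens (A A' B B' : D) :
    (ihom A).obj A' ⊗ (ihom B).obj B' ⟶ (ihom (A ⊗ B)).obj (A' ⊗ B') :=
  curry (tensorμ A B ((ihom A).obj A') ((ihom B).obj B') ≫ (evl A A' ⊗ₘ evl B B'))

theorem tens_ev (A A' B B' : D) :
    (A ⊗ B) ◁ tens A A' B B' ≫ evl (A ⊗ B) (A' ⊗ B') =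
    tensorμ A B ((ihom A).obj A') ((ihom B).obj B') ≫ (evl A A' ⊗ₘ evl B B') := by
  rw [← uncurry_eq, tens, uncurry_curry]

theorem comp_ev (A B E : D) :
    A ◁ comp A B E ≫ evl A E = (α_ _ _ _).inv ≫ evl A B ▷ _ ≫ evl B E := by
  rw [← uncurry_eq, MonoidalClosed.comp, uncurry_curry, compTranspose_eq]

theorem hom_ext' {X A B : D} {f g : X ⟶ (ihom A).obj B}
    (h : A ◁ f ≫ evl A B = A ◁ g ≫ evl A B) : f = g := by
  apply uncurry_injective; rwa [uncurry_eq, uncurry_eq]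

theorem id_ev (A : D) : A ◁ MonoidalClosed.id A ≫ evl A A = (ρ_ A).hom := by
  rw [← uncurry_eq, MonoidalClosed.id, uncurry_curry]

theorem curry'_ev {A B : D} (f : A ⟶ B) : A ◁ curry' f ≫ evl A B = (ρ_ A).hom ≫ f := by
  rw [← uncurry_eq, curry', uncurry_curry]

theorem pre_ev {A A' : D} (f : A ⟶ A') (B : D) :
    A ◁ (pre f).app B ≫ evl A B = f ▷ _ ≫ evl A' B := by
  rw [← uncurry_eq, uncurry_pre]

theorem map_ev {A B B' : D} (f : B ⟶ B') :
    A ◁ (ihom A).map f ≫ evl A B' = evl A B ≫ f := by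
  simp

theorem tensorμ_tensorδ' (X₁ X₂ Y₁ Y₂ : D) :
    tensorμ X₁ X₂ Y₁ Y₂ ≫ tensorμ X₁ Y₁ X₂ Y₂ = 𝟙 _ := by
  have : tensorμ X₁ Y₁ X₂ Y₂ = tensorδ X₁ X₂ Y₁ Y₂ := by
    simp [tensorμ, tensorδ, SymmetricCategory.braiding_swap_eq_inv_braiding X₂ Y₁]
  rw [this, tensorμ_tensorδ]

theorem tensorμ_braid (X₁ X₂ Y₁ Y₂ : D) :
    tensorμ X₁ X₂ Y₁ Y₂ ≫ (β_ (X₁ ⊗ Y₁) (X₂ ⊗ Y₂)).hom =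
      ((β_ X₁ X₂).hom ⊗ₘ (β_ Y₁ Y₂).hom) ≫ tensorμ X₂ X₁ Y₂ Y₁ := by
  simp [tensorμ, SymmetricCategory.braiding_swap_eq_inv_braiding Y₁ X₂, MonoidalCategory.tensorHom_def]

theorem tens_comp (A A' A'' B B' B'' : D) :
    tensorμ ((ihom A).obj A') ((ihom A').obj A'') ((ihom B).obj B') ((ihom B').obj B'') ≫
        (tens A A' B B' ⊗ₘ tens A' A'' B' B'') ≫
          comp (A ⊗ B) (A' ⊗ B') (A'' ⊗ B'') =
      (comp A A' A'' ⊗ₘ comp B B' B'') ≫ tens A A'' B B'' := by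
  apply hom_ext'
  simp only [MonoidalCategory.whiskerLeft_comp, Category.assoc, comp_ev, tens_ev]
  rw [tensorμ_natural_right_assoc, tensorHom_comp_tensorHom, comp_ev, comp_ev,
    ← tensorHom_comp_tensorHom, ← tensorHom_comp_tensorHom]
  rw [MonoidalCategory.tensorHom_def (tens A A' B B'), MonoidalCategory.whiskerLeft_comp_assoc,
    associator_inv_naturality_right_assoc, associator_inv_naturality_middle_assoc,
    whisker_exchange_assoc, tens_ev, ← comp_whiskerRight_assoc, tens_ev,
    comp_whiskerRight_assoc, tensorμ_natural_left_assoc]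
  have h1 := tensor_associativity A B ((ihom A).obj A') ((ihom B).obj B')
    ((ihom A').obj A'') ((ihom B').obj B'')
  have h2 : (A ⊗ B) ◁ tensorμ ((ihom A).obj A') ((ihom A').obj A'') ((ihom B).obj B')
        ((ihom B').obj B'') ≫ (α_ _ _ _).inv ≫ tensorμ A B ((ihom A).obj A') ((ihom B).obj B') ▷ _ ≫
        tensorμ _ _ _ _ = tensorμ _ _ _ _ ≫ ((α_ _ _ _).inv ⊗ₘ (α_ _ _ _).inv) := by
    rw [← cancel_mono ((α_ _ _ _).hom ⊗ₘ (α_ _ _ _).hom)]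
    simp only [Category.assoc]
    rw [h1, Iso.inv_hom_id_assoc, ← MonoidalCategory.whiskerLeft_comp_assoc, tensorHom_comp_tensorHom,
      Iso.inv_hom_id, Iso.inv_hom_id, MonoidalCategory.id_tensorHom_id, Category.comp_id]
    have h3 := tensorδ_tensorμ ((ihom A).obj A') ((ihom B).obj B') ((ihom A').obj A'')
      ((ihom B').obj B'')
    have h4 : tensorμ ((ihom A).obj A') ((ihom A').obj A'') ((ihom B).obj B') ((ihom B').obj B'') ≫
        tensorμ ((ihom A).obj A') ((ihom B).obj B') ((ihom A').obj A'') ((ihom B').obj B'') =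
        𝟙 _ := tensorμ_tensorδ' _ _ _ _
    rw [h4, MonoidalCategory.whiskerLeft_id, Category.id_comp]
  rw [reassoc_of% h2]


theorem tens_state {A A' B B' : D} (f : A ⟶ A') (g : B ⟶ B') :
    curry' (f ⊗ₘ g) =
      (λ_ (𝟙_ D)).inv ≫ (curry' f ⊗ₘ curry' g) ≫ tens A A' B B' := by
  apply hom_ext'
  simp only [MonoidalCategory.whiskerLeft_comp, Category.assoc, curry'_ev, tens_ev]
  rw [tensorμ_natural_right_assoc, tensorHom_comp_tensorHom, curry'_ev, curry'_ev,
    ← tensorHom_comp_tensorHom, tensor_right_unitality]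
  simp only [Category.assoc]

theorem tens_assoc (A A' B B' E E' : D) :
    tens A A' B B' ▷ (ihom E).obj E' ≫ tens (A ⊗ B) (A' ⊗ B') E E' ≫
        (ihom ((A ⊗ B) ⊗ E)).map (α_ A' B' E').hom =
      (α_ _ _ _).hom ≫
        (ihom A).obj A' ◁ tens B B' E E' ≫ tens A A' (B ⊗ E) (B' ⊗ E') ≫
          (pre (α_ A B E).hom).app (A' ⊗ B' ⊗ E') := by
  apply hom_ext'
  simp only [MonoidalCategory.whiskerLeft_comp, Category.assoc, pre_ev, map_ev]
  rw [reassoc_of% (tens_ev (A ⊗ B) (A' ⊗ B') E E'), ← MonoidalCategory.tensorHom_id (tens A A' B B'),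
    tensorμ_natural_right_assoc, tensorHom_comp_tensorHom_assoc, tens_ev, whisker_exchange_assoc,
    whisker_exchange_assoc, tens_ev, ← MonoidalCategory.id_tensorHom _ (tens B B' E E'),
    tensorμ_natural_right_assoc, tensorHom_comp_tensorHom, tens_ev]
  simp only [MonoidalCategory.whiskerLeft_id, Category.id_comp]
  have := associator_monoidal A B E ((ihom A).obj A') ((ihom B).obj B') ((ihom E).obj E')
  have h1 : (tensorμ A B ((ihom A).obj A') ((ihom B).obj B') ≫ (evl A A' ⊗ₘ evl B B')) ⊗ₘ evl E E' =
      (tensorμ A B ((ihom A).obj A') ((ihom B).obj B') ▷ _) ≫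
        ((evl A A' ⊗ₘ evl B B') ⊗ₘ evl E E') := by
    rw [← MonoidalCategory.tensorHom_id, tensorHom_comp_tensorHom, Category.id_comp]
  have h2 : evl A A' ⊗ₘ (tensorμ B E ((ihom B).obj B') ((ihom E).obj E') ≫
      (evl B B' ⊗ₘ evl E E')) = (_ ◁ tensorμ B E ((ihom B).obj B') ((ihom E).obj E')) ≫
        (evl A A' ⊗ₘ (evl B B' ⊗ₘ evl E E')) := by
    rw [← MonoidalCategory.id_tensorHom, tensorHom_comp_tensorHom, Category.id_comp]
  rw [h1, h2, Category.assoc, MonoidalCategory.associator_naturality, reassoc_of% this,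
    MonoidalCategory.tensorHom_def', Category.assoc]

theorem tens_left (A A' : D) :
    MonoidalClosed.id (𝟙_ D) ▷ (ihom A).obj A' ≫ tens (𝟙_ D) (𝟙_ D) A A' ≫
        (ihom (𝟙_ D ⊗ A)).map (λ_ A').hom =
      (λ_ ((ihom A).obj A')).hom ≫ (pre (λ_ A).hom).app A' := by
  apply hom_ext'
  simp only [MonoidalCategory.whiskerLeft_comp, Category.assoc, pre_ev, map_ev]
  rw [reassoc_of% (tens_ev (𝟙_ D) (𝟙_ D) A A'), ← MonoidalCategory.tensorHom_id,
    tensorμ_natural_right_assoc, tensorHom_comp_tensorHom_assoc, id_ev]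
  rw [MonoidalCategory.whiskerLeft_id, Category.id_comp, MonoidalCategory.tensorHom_def,
    Category.assoc, MonoidalCategory.leftUnitor_naturality, ← unitors_equal,
    ← leftUnitor_monoidal_assoc, MonoidalCategory.tensorHom_def', Category.assoc]

theorem tens_right (A A' : D) :
    (ihom A).obj A' ◁ MonoidalClosed.id (𝟙_ D) ≫ tens A A' (𝟙_ D) (𝟙_ D) ≫
        (ihom (A ⊗ 𝟙_ D)).map (ρ_ A').hom =
      (ρ_ ((ihom A).obj A')).hom ≫ (pre (ρ_ A).hom).app A' := by
  apply hom_ext'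
  simp only [MonoidalCategory.whiskerLeft_comp, Category.assoc, pre_ev, map_ev]
  rw [reassoc_of% (tens_ev A A' (𝟙_ D) (𝟙_ D)),
    ← MonoidalCategory.id_tensorHom _ (MonoidalClosed.id (𝟙_ D)),
    tensorμ_natural_right_assoc, tensorHom_comp_tensorHom_assoc, id_ev]
  rw [MonoidalCategory.whiskerLeft_id, Category.id_comp, MonoidalCategory.tensorHom_def',
    Category.assoc, MonoidalCategory.rightUnitor_naturality, ← unitors_equal,
    ← rightUnitor_monoidal_assoc, MonoidalCategory.tensorHom_def', Category.assoc]

theorem tens_left' {J : D} (e : J ⟶ 𝟙_ D) (A A' : D) :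
    MonoidalClosed.id J ▷ (ihom A).obj A' ≫ tens J J A A' ≫
        (ihom (J ⊗ A)).map (e ▷ A' ≫ (λ_ A').hom) =
      (λ_ ((ihom A).obj A')).hom ≫ (pre (e ▷ A ≫ (λ_ A).hom)).app A' := by
  have h0 := tens_left A A'
  have h := congrArg (fun t => (e ▷ A) ▷ _ ≫ (𝟙_ D ⊗ A) ◁ t ≫ evl (𝟙_ D ⊗ A) A') h0
  simp only [MonoidalCategory.whiskerLeft_comp, Category.assoc, pre_ev, map_ev] at h
  apply hom_ext'
  simp only [MonoidalCategory.whiskerLeft_comp, Category.assoc, pre_ev, map_ev]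
  rw [reassoc_of% (tens_ev (𝟙_ D) (𝟙_ D) A A'),
    ← MonoidalCategory.tensorHom_id (MonoidalClosed.id (𝟙_ D)),
    tensorμ_natural_right_assoc, tensorHom_comp_tensorHom_assoc, id_ev,
    ← MonoidalCategory.tensorHom_id e A, tensorμ_natural_left_assoc,
    tensorHom_comp_tensorHom_assoc, MonoidalCategory.rightUnitor_naturality] at h
  rw [reassoc_of% (tens_ev J J A A'), ← MonoidalCategory.tensorHom_id (MonoidalClosed.id J),
    tensorμ_natural_right_assoc, tensorHom_comp_tensorHom_assoc, id_ev,
    ← MonoidalCategory.tensorHom_id e A', tensorHom_comp_tensorHom_assoc]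
  simp only [Category.comp_id, Category.id_comp, MonoidalCategory.id_whiskerRight,
    MonoidalCategory.whiskerLeft_id] at h ⊢
  rw [h, MonoidalCategory.tensorHom_id, ← whisker_exchange_assoc,
    comp_whiskerRight_assoc]

theorem tens_right' {J : D} (e : J ⟶ 𝟙_ D) (A A' : D) :
    (ihom A).obj A' ◁ MonoidalClosed.id J ≫ tens A A' J J ≫
        (ihom (A ⊗ J)).map (A' ◁ e ≫ (ρ_ A').hom) =
      (ρ_ ((ihom A).obj A')).hom ≫ (pre (A ◁ e ≫ (ρ_ A).hom)).app A' := by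
  have h0 := tens_right A A'
  have h := congrArg (fun t => (A ◁ e) ▷ _ ≫ (A ⊗ 𝟙_ D) ◁ t ≫ evl (A ⊗ 𝟙_ D) A') h0
  simp only [MonoidalCategory.whiskerLeft_comp, Category.assoc, pre_ev, map_ev] at h
  apply hom_ext'
  simp only [MonoidalCategory.whiskerLeft_comp, Category.assoc, pre_ev, map_ev]
  rw [reassoc_of% (tens_ev A A' (𝟙_ D) (𝟙_ D)),
    ← MonoidalCategory.id_tensorHom _ (MonoidalClosed.id (𝟙_ D)),
    tensorμ_natural_right_assoc, tensorHom_comp_tensorHom_assoc, id_ev,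
    ← MonoidalCategory.id_tensorHom A e, tensorμ_natural_left_assoc,
    tensorHom_comp_tensorHom_assoc, MonoidalCategory.rightUnitor_naturality] at h
  rw [reassoc_of% (tens_ev A A' J J), ← MonoidalCategory.id_tensorHom _ (MonoidalClosed.id J),
    tensorμ_natural_right_assoc, tensorHom_comp_tensorHom_assoc, id_ev,
    ← MonoidalCategory.id_tensorHom A' e, tensorHom_comp_tensorHom_assoc]
  simp only [Category.comp_id, Category.id_comp, MonoidalCategory.id_whiskerRight,
    MonoidalCategory.whiskerLeft_id] at h ⊢
  rw [h, MonoidalCategory.id_tensorHom, ← whisker_exchange_assoc,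
    comp_whiskerRight_assoc]

theorem tens_braid (A A' B B' : D) :
    tens A A' B B' ≫ (ihom (A ⊗ B)).map (β_ A' B').hom =
      (β_ _ _).hom ≫ tens B B' A A' ≫ (pre (β_ A B).hom).app (B' ⊗ A') := by
  apply hom_ext'
  simp only [MonoidalCategory.whiskerLeft_comp, Category.assoc, pre_ev, map_ev]
  rw [reassoc_of% (tens_ev A A' B B'), whisker_exchange_assoc, tens_ev,
    BraidedCategory.braiding_naturality, reassoc_of% (tensorμ_braid A B), MonoidalCategory.tensorHom_def']
  simp only [Category.assoc]
end Closed

/-- A class of objects closed under tensor products and containing an object isomorphic to the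
monoidal unit. -/
structure SubSMC (D : Type u) [Category.{v} D] [MonoidalCategory D] where
  P : ObjectProperty D
  tensor_mem {A B : D} : P A → P B → P (A ⊗ B)
  unit : D
  unit_mem : P unit
  unitIso : unit ≅ 𝟙_ D

namespace SubSMC
variable {D : Type u} [Category.{v} D] [MonoidalCategory D]

/-- The full subcategory on a `SubSMC`; it is symmetric monoidal with the tensor product of `D` and
with unit object `S.unit`. -/
def Cat (S : SubSMC D) : Type u := S.P.FullSubcategory

variable (S T : SubSMC D)

instance : Category S.Cat := inferInstanceAs (Category S.P.FullSubcategory)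

/-- The inclusion functor. -/
def incl : S.Cat ⥤ D := S.P.ι

instance : S.incl.Faithful := inferInstanceAs S.P.ι.Faithful

variable {S}

/-- The underlying object in the ambient category. -/
def obj (A : S.Cat) : D := ObjectProperty.FullSubcategory.obj A

/-- An object of the subcategory from an object of the ambient category. -/
def ofObj (A : D) (hA : S.P A) : S.Cat := ObjectProperty.FullSubcategory.mk A hA

theorem mem (A : S.Cat) : S.P (obj A) := ObjectProperty.FullSubcategory.property A

/-- A morphism of the full subcategory from a morphism of the ambient category. -/
def lift {A B : S.Cat} (f : obj A ⟶ obj B) : A ⟶ B := ObjectProperty.homMk f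

/-- An isomorphism of the full subcategory from one of the ambient category. -/
def isoLift {A B : S.Cat} (e : obj A ≅ obj B) : A ≅ B := ObjectProperty.isoMk S.P e

/-- The underlying morphism in the ambient category. -/
def dn {A B : S.Cat} (f : A ⟶ B) : obj A ⟶ obj B := ObjectProperty.ι S.P |>.map f

theorem hom_ext {A B : S.Cat} {f g : A ⟶ B} (h : dn f = dn g) : f = g :=
  S.P.ι.map_injective h

@[simp] theorem dn_lift {A B : S.Cat} (f : obj A ⟶ obj B) : dn (lift f) = f := rfl
@[simp] theorem lift_dn {A B : S.Cat} (f : A ⟶ B) : lift (dn f) = f := rfl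
@[simp] theorem dn_id (A : S.Cat) : dn (𝟙 A) = 𝟙 (obj A) := rfl
@[simp] theorem dn_comp {A B E : S.Cat} (f : A ⟶ B) (g : B ⟶ E) :
    dn (f ≫ g) = dn f ≫ dn g := rfl
@[simp] theorem dn_isoLift_hom {A B : S.Cat} (e : obj A ≅ obj B) :
    dn (isoLift e).hom = e.hom := rfl
@[simp] theorem dn_isoLift_inv {A B : S.Cat} (e : obj A ≅ obj B) :
    dn (isoLift e).inv = e.inv := rfl

variable (S) in
instance : MonoidalCategoryStruct S.Cat where
  tensorObj A B := ofObj (obj A ⊗ obj B) (S.tensor_mem (mem A) (mem B))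
  whiskerLeft A _ _ f := lift (obj A ◁ dn f)
  whiskerRight f B := lift (dn f ▷ obj B)
  tensorHom f g := lift (dn f ⊗ₘ dn g)
  tensorUnit := ofObj S.unit S.unit_mem
  associator A B E := isoLift (α_ (obj A) (obj B) (obj E))
  leftUnitor A := isoLift (whiskerRightIso S.unitIso (obj A) ≪≫ λ_ (obj A))
  rightUnitor A := isoLift (whiskerLeftIso (obj A) S.unitIso ≪≫ ρ_ (obj A))

@[simp] theorem obj_tensor (A B : S.Cat) : obj (A ⊗ B) = obj A ⊗ obj B := rfl
@[simp] theorem obj_unit : obj (𝟙_ S.Cat) = S.unit := rfl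
@[simp] theorem dn_whiskerLeft (A : S.Cat) {B E : S.Cat} (f : B ⟶ E) :
    dn (A ◁ f) = obj A ◁ dn f := rfl
@[simp] theorem dn_whiskerRight {B E : S.Cat} (f : B ⟶ E) (A : S.Cat) :
    dn (f ▷ A) = dn f ▷ obj A := rfl
@[simp] theorem dn_tensorHom {A B E F : S.Cat} (f : A ⟶ B) (g : E ⟶ F) :
    dn (f ⊗ₘ g) = dn f ⊗ₘ dn g := rfl
@[simp] theorem dn_assoc_hom (A B E : S.Cat) : dn (α_ A B E).hom = (α_ _ _ _).hom := rfl
@[simp] theorem dn_assoc_inv (A B E : S.Cat) : dn (α_ A B E).inv = (α_ _ _ _).inv := rfl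
@[simp] theorem dn_left_hom (A : S.Cat) :
    dn (λ_ A).hom = S.unitIso.hom ▷ obj A ≫ (λ_ (obj A)).hom := rfl
@[simp] theorem dn_left_inv (A : S.Cat) :
    dn (λ_ A).inv = (λ_ (obj A)).inv ≫ S.unitIso.inv ▷ obj A := rfl
@[simp] theorem dn_right_hom (A : S.Cat) :
    dn (ρ_ A).hom = obj A ◁ S.unitIso.hom ≫ (ρ_ (obj A)).hom := rfl
@[simp] theorem dn_right_inv (A : S.Cat) :
    dn (ρ_ A).inv = (ρ_ (obj A)).inv ≫ obj A ◁ S.unitIso.inv := rfl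

variable (S) in
/-- The comparison data that induce the monoidal category axioms from the ambient category. -/
def inclData : Monoidal.InducingFunctorData S.incl where
  μIso A B := Iso.refl (obj A ⊗ obj B)
  εIso := S.unitIso.symm
  whiskerLeft_eq A _ _ f := by
    change dn (A ◁ f) = 𝟙 _ ≫ (obj A ◁ dn f) ≫ 𝟙 _
    simp
  whiskerRight_eq f B := by
    change dn (f ▷ B) = 𝟙 _ ≫ (dn f ▷ obj B) ≫ 𝟙 _
    simp
  tensorHom_eq f g := by
    change dn (f ⊗ₘ g) = 𝟙 _ ≫ (dn f ⊗ₘ dn g) ≫ 𝟙 _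
    simp
  associator_eq A B E := by
    change (α_ (obj A) (obj B) (obj E)).hom =
      (𝟙 _ ≫ (𝟙 (obj A ⊗ obj B) ⊗ₘ 𝟙 (obj E))) ≫ (α_ (obj A) (obj B) (obj E)).hom ≫
        (𝟙 (obj A) ⊗ₘ 𝟙 (obj B ⊗ obj E)) ≫ 𝟙 _
    simp
  leftUnitor_eq A := by
    change S.unitIso.hom ▷ obj A ≫ (λ_ (obj A)).hom =
      (𝟙 _ ≫ (S.unitIso.hom ⊗ₘ 𝟙 (obj A))) ≫ (λ_ (obj A)).hom
    simp
  rightUnitor_eq A := by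
    change obj A ◁ S.unitIso.hom ≫ (ρ_ (obj A)).hom =
      (𝟙 _ ≫ (𝟙 (obj A) ⊗ₘ S.unitIso.hom)) ≫ (ρ_ (obj A)).hom
    simp

instance : MonoidalCategory S.Cat := Monoidal.induced S.incl S.inclData

end SubSMC

namespace SubSMC
variable {D : Type u} [Category.{v} D] [MonoidalCategory D] [SymmetricCategory D]
variable {S T : SubSMC D}

instance : SymmetricCategory S.Cat where
  braiding A B := isoLift (β_ (obj A) (obj B))
  braiding_naturality_right _ _ _ _ := hom_ext (BraidedCategory.braiding_naturality_right _ _)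
  braiding_naturality_left _ _ := hom_ext (BraidedCategory.braiding_naturality_left _ _)
  hexagon_forward _ _ _ := hom_ext (BraidedCategory.hexagon_forward _ _ _)
  hexagon_reverse _ _ _ := hom_ext (BraidedCategory.hexagon_reverse _ _ _)
  symmetry _ _ := hom_ext (SymmetricCategory.symmetry _ _)

@[simp] theorem dn_braid_hom (A B : S.Cat) : dn (β_ A B).hom = (β_ (obj A) (obj B)).hom := rfl

@[simp] theorem dn_tensorμ (A B E F : S.Cat) :
    dn (tensorμ A B E F) = tensorμ (obj A) (obj B) (obj E) (obj F) := rfl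

variable [MonoidalClosed D]

open MonoidalClosed in
/-- If the internal hom of two objects of `S` lies in `T`, then `S.Cat` is enriched over `T.Cat` by
the internal hom. -/
@[reducible]
def enrichedCategory (h : ∀ A B : D, S.P A → S.P B → T.P ((ihom A).obj B)) :
    EnrichedCategory T.Cat S.Cat where
  Hom A B := ofObj ((ihom (obj A)).obj (obj B)) (h _ _ (mem A) (mem B))
  id A := lift (T.unitIso.hom ≫ MonoidalClosed.id (obj A))
  comp A B E := lift (MonoidalClosed.comp (obj A) (obj B) (obj E))
  id_comp A B := hom_ext (by
    change ((λ_ ((ihom (obj A)).obj (obj B))).inv ≫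
      T.unitIso.inv ▷ ((ihom (obj A)).obj (obj B))) ≫
        (T.unitIso.hom ≫ MonoidalClosed.id (obj A)) ▷ ((ihom (obj A)).obj (obj B)) ≫
          MonoidalClosed.comp (obj A) (obj A) (obj B) = 𝟙 _
    rw [Category.assoc, ← comp_whiskerRight_assoc, Iso.inv_hom_id_assoc]
    exact MonoidalClosed.id_comp (obj A) (obj B))
  comp_id A B := hom_ext (by
    change ((ρ_ ((ihom (obj A)).obj (obj B))).inv ≫
      ((ihom (obj A)).obj (obj B)) ◁ T.unitIso.inv) ≫
        ((ihom (obj A)).obj (obj B)) ◁ (T.unitIso.hom ≫ MonoidalClosed.id (obj B)) ≫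
          MonoidalClosed.comp (obj A) (obj B) (obj B) = 𝟙 _
    rw [Category.assoc, ← MonoidalCategory.whiskerLeft_comp_assoc, Iso.inv_hom_id_assoc]
    exact MonoidalClosed.comp_id (obj A) (obj B))
  assoc A B E F := hom_ext (MonoidalClosed.assoc (obj A) (obj B) (obj E) (obj F))

open MonoidalClosed in
/-- The enrichment by internal homs, with `κ` the transposition of `A ⟶ B` to a state of the internal
hom. -/
@[reducible]
def enrichedOrdinaryCategory (h : ∀ A B : D, S.P A → S.P B → T.P ((ihom A).obj B)) :
    EnrichedOrdinaryCategory T.Cat S.Cat where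
  toEnrichedCategory := enrichedCategory h
  homEquiv {A B} :=
    { toFun f := lift (T.unitIso.hom ≫ curry' (dn f))
      invFun g := lift (uncurry' (T.unitIso.inv ≫ dn g))
      left_inv f := hom_ext (by
        change uncurry' (T.unitIso.inv ≫ T.unitIso.hom ≫ curry' (dn f)) = dn f
        rw [Iso.inv_hom_id_assoc, uncurry'_curry'])
      right_inv g := hom_ext (by
        change T.unitIso.hom ≫ curry' (uncurry' (T.unitIso.inv ≫ dn g)) = dn g
        rw [curry'_uncurry']
        exact T.unitIso.hom_inv_id_assoc (dn g)) }
  homEquiv_id A := hom_ext (by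
    change T.unitIso.hom ≫ curry' (𝟙 (obj A)) = T.unitIso.hom ≫ MonoidalClosed.id (obj A)
    rw [curry'_id])
  homEquiv_comp {A B E} f g := hom_ext (by
    change T.unitIso.hom ≫ curry' (dn f ≫ dn g) =
      ((λ_ T.unit).inv ≫ T.unitIso.inv ▷ T.unit) ≫
        (T.unitIso.hom ≫ curry' (dn f) ⊗ₘ T.unitIso.hom ≫ curry' (dn g)) ≫
          MonoidalClosed.comp (obj A) (obj B) (obj E)
    rw [curry'_comp, ← tensorHom_comp_tensorHom_assoc]
    simp [MonoidalCategory.tensorHom_def])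


section
variable (h : ∀ A B : D, S.P A → S.P B → T.P ((ihom A).obj B))

theorem dn_eHomWhiskerLeft (A : S.Cat) {B B' : S.Cat} (g : B ⟶ B') :
    letI := enrichedOrdinaryCategory h
    dn (eHomWhiskerLeft T.Cat A g) = (ihom (obj A)).map (dn g) := by
  let _ := enrichedOrdinaryCategory h
  change ((ρ_ ((ihom (obj A)).obj (obj B))).inv ≫
    ((ihom (obj A)).obj (obj B)) ◁ T.unitIso.inv) ≫
      ((ihom (obj A)).obj (obj B)) ◁ (T.unitIso.hom ≫ MonoidalClosed.curry' (dn g)) ≫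
        MonoidalClosed.comp (obj A) (obj B) (obj B') = _
  rw [Category.assoc, ← MonoidalCategory.whiskerLeft_comp_assoc, Iso.inv_hom_id_assoc,
    MonoidalClosed.whiskerLeft_curry'_comp, Iso.inv_hom_id_assoc]

theorem dn_eHomWhiskerRight {A A' : S.Cat} (g : A ⟶ A') (B : S.Cat) :
    letI := enrichedOrdinaryCategory h
    dn (eHomWhiskerRight T.Cat g B) = (MonoidalClosed.pre (dn g)).app (obj B) := by
  let _ := enrichedOrdinaryCategory h
  change ((λ_ ((ihom (obj A')).obj (obj B))).inv ≫
      T.unitIso.inv ▷ ((ihom (obj A')).obj (obj B))) ≫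
        (T.unitIso.hom ≫ MonoidalClosed.curry' (dn g)) ▷ ((ihom (obj A')).obj (obj B)) ≫
          MonoidalClosed.comp (obj A) (obj A') (obj B) = _
  rw [Category.assoc, ← comp_whiskerRight_assoc, Iso.inv_hom_id_assoc,
    MonoidalClosed.curry'_whiskerRight_comp, Iso.inv_hom_id_assoc]

/-- The symmetric monoidal enrichment of `S.Cat` over `T.Cat` by internal homs. -/
@[reducible]
def enrichedSMC : EnrichedSMC T.Cat S.Cat where
  toEnrichedOrdinaryCategory := enrichedOrdinaryCategory h
  eTensor A A' B B' := lift (tens (obj A) (obj A') (obj B) (obj B'))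
  eHomEquiv_tensor {A A' B B'} f g := hom_ext (by
    change T.unitIso.hom ≫ MonoidalClosed.curry' (dn f ⊗ₘ dn g) =
      ((λ_ T.unit).inv ≫ T.unitIso.inv ▷ T.unit) ≫
        (T.unitIso.hom ≫ MonoidalClosed.curry' (dn f) ⊗ₘ
          T.unitIso.hom ≫ MonoidalClosed.curry' (dn g)) ≫
          tens (obj A) (obj A') (obj B) (obj B')
    rw [tens_state, ← tensorHom_comp_tensorHom_assoc]
    simp [MonoidalCategory.tensorHom_def])
  eTensor_comp A A' A'' B B' B'' := hom_ext (tens_comp _ _ _ _ _ _)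
  associator_eNatural A A' B B' E E' := hom_ext (by
    let _ := enrichedOrdinaryCategory h
    have := tens_assoc (obj A) (obj A') (obj B) (obj B') (obj E) (obj E')
    have h1 := dn_eHomWhiskerLeft h ((A ⊗ B) ⊗ E) (α_ A' B' E').hom
    have h2 := dn_eHomWhiskerRight h (α_ A B E).hom (A' ⊗ B' ⊗ E')
    simp only [dn_comp, h1, h2]
    exact this)
  leftUnitor_eNatural A A' := hom_ext (by
    let _ := enrichedOrdinaryCategory h
    have := tens_left' S.unitIso.hom (obj A) (obj A')
    have h1 := dn_eHomWhiskerLeft h (𝟙_ S.Cat ⊗ A) (λ_ A').hom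
    have h2 := dn_eHomWhiskerRight h (λ_ A).hom A'
    simp only [dn_comp, h1, h2]
    change (T.unitIso.hom ≫ MonoidalClosed.id S.unit) ▷ ((ihom (obj A)).obj (obj A')) ≫
      tens S.unit S.unit (obj A) (obj A') ≫
        (ihom (S.unit ⊗ obj A)).map (S.unitIso.hom ▷ obj A' ≫ (λ_ (obj A')).hom) =
      (T.unitIso.hom ▷ ((ihom (obj A)).obj (obj A')) ≫ (λ_ _).hom) ≫
        (MonoidalClosed.pre (S.unitIso.hom ▷ obj A ≫ (λ_ (obj A)).hom)).app (obj A')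
    rw [comp_whiskerRight_assoc, this, Category.assoc])
  rightUnitor_eNatural A A' := hom_ext (by
    let _ := enrichedOrdinaryCategory h
    have := tens_right' S.unitIso.hom (obj A) (obj A')
    have h1 := dn_eHomWhiskerLeft h (A ⊗ 𝟙_ S.Cat) (ρ_ A').hom
    have h2 := dn_eHomWhiskerRight h (ρ_ A).hom A'
    simp only [dn_comp, h1, h2]
    change ((ihom (obj A)).obj (obj A')) ◁ (T.unitIso.hom ≫ MonoidalClosed.id S.unit) ≫
      tens (obj A) (obj A') S.unit S.unit ≫
        (ihom (obj A ⊗ S.unit)).map (obj A' ◁ S.unitIso.hom ≫ (ρ_ (obj A')).hom) =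
      (((ihom (obj A)).obj (obj A')) ◁ T.unitIso.hom ≫ (ρ_ _).hom) ≫
        (MonoidalClosed.pre (obj A ◁ S.unitIso.hom ≫ (ρ_ (obj A)).hom)).app (obj A')
    rw [MonoidalCategory.whiskerLeft_comp_assoc, this, Category.assoc])
  braiding_eNatural A A' B B' := hom_ext (by
    let _ := enrichedOrdinaryCategory h
    have := tens_braid (obj A) (obj A') (obj B) (obj B')
    have h1 := dn_eHomWhiskerLeft h (A ⊗ B) (β_ A' B').hom
    have h2 := dn_eHomWhiskerRight h (β_ A B).hom (B' ⊗ A')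
    simp only [dn_comp, h1, h2]
    exact this)

end

end SubSMC

section Precausal
variable (C : Type u) [Category.{v} C] [MonoidalCategory C]

/-- A discarding effect on every object, compatible with tensor products and the unit. -/
class Discarding where
  discard (A : C) : A ⟶ 𝟙_ C
  discard_tensor (A B : C) : discard (A ⊗ B) = (discard A ⊗ₘ discard B) ≫ (λ_ (𝟙_ C)).hom
  discard_unit : discard (𝟙_ C) = 𝟙 (𝟙_ C)

variable {C}

/-- The discarding effect. -/
abbrev discard [Discarding C] (A : C) : A ⟶ 𝟙_ C := Discarding.discard A

/-- A morphism is causal if it preserves discarding. -/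
def IsCausal [Discarding C] {A B : C} (f : A ⟶ B) : Prop := f ≫ discard B = discard A

/-- The cup of the compact structure. -/
abbrev cup [LeftRigidCategory C] (A : C) : 𝟙_ C ⟶ (ᘁA) ⊗ A := η_ (ᘁA) A

/-- The cap of the compact structure. -/
abbrev cap [LeftRigidCategory C] (A : C) : A ⊗ (ᘁA) ⟶ 𝟙_ C := ε_ (ᘁA) A

/-- The (unnormalised) uniform state: the transpose of discarding on the dual object. -/
def uniform [LeftRigidCategory C] [Discarding C] (A : C) : 𝟙_ C ⟶ A :=
  cup A ≫ discard (ᘁA) ▷ A ≫ (λ_ A).hom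

/-- The state of the dual object that is the transpose of an effect. -/
def effectState [LeftRigidCategory C] {A : C} (π : A ⟶ 𝟙_ C) : 𝟙_ C ⟶ (ᘁA) :=
  cup A ≫ (ᘁA) ◁ π ≫ (ρ_ (ᘁA)).hom

/-- The trace of an endomorphism: the circle formed with the compact structure. -/
def trace [SymmetricCategory C] [LeftRigidCategory C] {A : C} (f : A ⟶ A) : 𝟙_ C ⟶ 𝟙_ C :=
  cup A ≫ (ᘁA) ◁ f ≫ (β_ (ᘁA) A).hom ≫ cap A

end Precausal

/-- A pre-causal category: a compact closed category (symmetric, with duals) with compatible discarding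
such that dimensions of non-zero objects are invertible, there are enough causal states, one-way
signalling causal processes factorise, and every effect on causal processes that gives one on each
of them discards the output and inserts a causal state (`Φ : A ⟶ B` and `w : B ⟶ A` being paired by
the trace). The first three fields say that discarding is multiplicative also through duals, i.e.
that it respects the identifications `I* = I`, `(A ⊗ B)* = A* ⊗ B*` and `A** = A`. -/
class PrecausalCategory (C : Type u) [Category.{v} C] [MonoidalCategory C] [SymmetricCategory C]
    [LeftRigidCategory C] extends Discarding C where
  uniform_unit : uniform (𝟙_ C) = 𝟙 (𝟙_ C)
  uniform_tensor (A B : C) : uniform (A ⊗ B) = (λ_ (𝟙_ C)).inv ≫ (uniform A ⊗ₘ uniform B)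
  uniform_dual (A : C) : uniform (ᘁA) = effectState (discard A)
  isIso_dim (A : C) (hA : ¬ Limits.IsZero A) : IsIso (uniform A ≫ discard A)
  enough_causal_states {A B : C} (f g : A ⟶ B)
    (h : ∀ ρ : 𝟙_ C ⟶ A, IsCausal ρ → ρ ≫ f = ρ ≫ g) : f = g
  factorise_one_way {A B A' B' : C} (Φ : A ⊗ B ⟶ A' ⊗ B') (hΦ : IsCausal Φ)
    (h : ∃ Φ' : A ⟶ A', IsCausal Φ' ∧
      Φ ≫ A' ◁ discard B' ≫ (ρ_ A').hom = A ◁ discard B ≫ (ρ_ A).hom ≫ Φ') :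
    ∃ (Z : C) (Φ₁ : A ⟶ A' ⊗ Z) (Φ₂ : Z ⊗ B ⟶ B'), IsCausal Φ₁ ∧ IsCausal Φ₂ ∧
      Φ = Φ₁ ▷ B ≫ (α_ A' Z B).hom ≫ A' ◁ Φ₂
  factorise_dual {A B : C} (w : B ⟶ A)
    (h : ∀ Φ : A ⟶ B, IsCausal Φ → trace (Φ ≫ w) = 𝟙 (𝟙_ C)) :
    ∃ ρ : 𝟙_ C ⟶ A, IsCausal ρ ∧ w = discard B ≫ ρ

section Dual
variable {C : Type u} [Category.{v} C] [MonoidalCategory C]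

/-- The dual `c*` of a set of states, as a set of effects. -/
def dualSet {A : C} (c : Set (𝟙_ C ⟶ A)) : Set (A ⟶ 𝟙_ C) :=
  {π | ∀ ρ ∈ c, ρ ≫ π = 𝟙 (𝟙_ C)}

/-- The dual of a set of effects, as a set of states. -/
def predualSet {A : C} (e : Set (A ⟶ 𝟙_ C)) : Set (𝟙_ C ⟶ A) :=
  {ρ | ∀ π ∈ e, ρ ≫ π = 𝟙 (𝟙_ C)}

theorem predual_dual_predual {A : C} (e : Set (A ⟶ 𝟙_ C)) :
    predualSet (dualSet (predualSet e)) = predualSet e :=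
  Set.Subset.antisymm (fun _ hρ π hπ => hρ π fun _ hσ => hσ π hπ) (fun ρ hρ _ hπ => hπ ρ hρ)

theorem dual_predual_dual {A : C} (c : Set (𝟙_ C ⟶ A)) :
    dualSet (predualSet (dualSet c)) = dualSet c :=
  Set.Subset.antisymm (fun _ hπ ρ hρ => hπ ρ fun _ h => h ρ hρ) (fun π hπ _ hρ => hρ π hπ)

/-- The product of two states. -/
def tensorState {A B : C} (ρ : 𝟙_ C ⟶ A) (σ : 𝟙_ C ⟶ B) : 𝟙_ C ⟶ A ⊗ B :=
  (λ_ (𝟙_ C)).inv ≫ (ρ ⊗ₘ σ)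

/-- The product of two effects. -/
def tensorEffect {A B : C} (π : A ⟶ 𝟙_ C) (ξ : B ⟶ 𝟙_ C) : A ⊗ B ⟶ 𝟙_ C :=
  (π ⊗ₘ ξ) ≫ (λ_ (𝟙_ C)).hom

end Dual

/-- An object `(X, c)` of `Caus[C]`: a set of states with `c** = c` that is flat, i.e. up to invertible
scalars the uniform state lies in `c` and discarding lies in `c*`. -/
structure CausType (C : Type u) [Category.{v} C] [MonoidalCategory C] [SymmetricCategory C]
    [LeftRigidCategory C] [PrecausalCategory C] where
  X : C
  states : Set (𝟙_ C ⟶ X)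
  closed : predualSet (dualSet states) = states
  flat_uniform : ∃ s : 𝟙_ C ≅ 𝟙_ C, s.hom ≫ uniform X ∈ states
  flat_discard : ∃ s : 𝟙_ C ≅ 𝟙_ C, discard X ≫ s.hom ∈ dualSet states

/-- A partial order on every hom-set for which sequential and parallel composition are monotone: `C` as
a locally posetal monoidal 2-category. -/
structure HomOrder (C : Type u) [Category.{v} C] [MonoidalCategory C] where
  le {A B : C} : (A ⟶ B) → (A ⟶ B) → Prop
  refl {A B : C} (f : A ⟶ B) : le f f
  trans {A B : C} {f g h : A ⟶ B} : le f g → le g h → le f h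
  antisymm {A B : C} {f g : A ⟶ B} : le f g → le g f → f = g
  comp {A B E : C} {f f' : A ⟶ B} {g g' : B ⟶ E} : le f f' → le g g' → le (f ≫ g) (f' ≫ g')
  tensor {A B A' B' : C} {f f' : A ⟶ B} {g g' : A' ⟶ B'} :
    le f f' → le g g' → le (f ⊗ₘ g) (f' ⊗ₘ g')

/-- The discrete order. -/
def HomOrder.discrete (C : Type u) [Category.{v} C] [MonoidalCategory C] : HomOrder C where
  le f g := f = g
  refl _ := rfl
  trans h h' := h.trans h'
  antisymm h _ := h
  comp h h' := by rw [h, h']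
  tensor h h' := by rw [h, h']

namespace CausType
variable {C : Type u} [Category.{v} C] [MonoidalCategory C] [SymmetricCategory C]
  [LeftRigidCategory C] [PrecausalCategory C]

/-- `f` maps the states of `A` to states of `B`, i.e. `f` is a morphism `A ⟶ B` of `Caus[C]`. -/
def Preserves (A B : CausType C) (f : A.X ⟶ B.X) : Prop :=
  ∀ ρ ∈ A.states, ρ ≫ f ∈ B.states

theorem tensorState_tensor {A B A' B' : C} (ρ : 𝟙_ C ⟶ A) (σ : 𝟙_ C ⟶ B) (f : A ⟶ A')
    (g : B ⟶ B') : tensorState ρ σ ≫ (f ⊗ₘ g) = tensorState (ρ ≫ f) (σ ≫ g) := by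
  simp [tensorState]

theorem tensorState_effect {A B : C} (ρ : 𝟙_ C ⟶ A) (σ : 𝟙_ C ⟶ B) (π : A ⟶ 𝟙_ C)
    (ξ : B ⟶ 𝟙_ C) : tensorState ρ σ ≫ tensorEffect π ξ = (ρ ≫ π) ≫ (σ ≫ ξ) := by
  rw [tensorEffect, ← Category.assoc, tensorState_tensor, tensorState, Category.assoc,
    MonoidalCategory.tensorHom_def, Category.assoc, MonoidalCategory.leftUnitor_naturality,
    unitors_equal, MonoidalCategory.rightUnitor_naturality_assoc, ← unitors_equal,
    Iso.inv_hom_id_assoc]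

theorem scalar_comm (s t : 𝟙_ C ⟶ 𝟙_ C) : s ≫ t = t ≫ s := by
  have h1 : (λ_ (𝟙_ C)).inv ≫ (s ⊗ₘ t) ≫ (λ_ (𝟙_ C)).hom = s ≫ t := by
    rw [MonoidalCategory.tensorHom_def, Category.assoc, MonoidalCategory.leftUnitor_naturality,
      unitors_equal, MonoidalCategory.rightUnitor_naturality_assoc, ← unitors_equal,
      Iso.inv_hom_id_assoc]
  have h2 : (λ_ (𝟙_ C)).inv ≫ (s ⊗ₘ t) ≫ (λ_ (𝟙_ C)).hom = t ≫ s := by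
    rw [MonoidalCategory.tensorHom_def', Category.assoc, unitors_equal,
      MonoidalCategory.rightUnitor_naturality, ← unitors_equal,
      MonoidalCategory.leftUnitor_naturality_assoc, Iso.inv_hom_id_assoc]
  rw [← h1, h2]

theorem tensorState_scalar {A B : C} (s t : 𝟙_ C ⟶ 𝟙_ C) (ρ : 𝟙_ C ⟶ A) (σ : 𝟙_ C ⟶ B) :
    tensorState (s ≫ ρ) (t ≫ σ) = (s ≫ t) ≫ tensorState ρ σ := by
  have h := tensorState_effect (𝟙 _) (𝟙 _) s t
  rw [tensorEffect, ← Category.assoc, tensorState_tensor, Category.id_comp, Category.id_comp] at h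
  rw [← h, ← tensorState_tensor]
  simp [tensorState]

theorem tensorEffect_scalar {A B : C} (s t : 𝟙_ C ⟶ 𝟙_ C) (π : A ⟶ 𝟙_ C) (ξ : B ⟶ 𝟙_ C) :
    tensorEffect (π ≫ s) (ξ ≫ t) = tensorEffect π ξ ≫ (s ≫ t) := by
  have h := tensorState_effect (𝟙 _) (𝟙 _) s t
  rw [Category.id_comp, Category.id_comp] at h
  rw [← h]
  simp [tensorState, tensorEffect]

/-- The state that is the transpose of an effect on the dual object. -/
def toState {A : C} (π : (ᘁA) ⟶ 𝟙_ C) : 𝟙_ C ⟶ A :=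
  cup A ≫ π ▷ A ≫ (λ_ A).hom

/-- The effect on the dual object that is the transpose of a state. -/
def toEffect {A : C} (ρ : 𝟙_ C ⟶ A) : (ᘁA) ⟶ 𝟙_ C :=
  (λ_ (ᘁA)).inv ≫ ρ ▷ (ᘁA) ≫ cap A

theorem effectState_comp {A : C} (x : A ⟶ 𝟙_ C) (π : (ᘁA) ⟶ 𝟙_ C) :
    effectState x ≫ π = toState π ≫ x := by
  simp only [effectState, toState, Category.assoc]
  rw [← MonoidalCategory.rightUnitor_naturality, ← MonoidalCategory.leftUnitor_naturality,
    whisker_exchange_assoc, unitors_equal]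

theorem toState_toEffect {A : C} (ρ : 𝟙_ C ⟶ A) : toState (toEffect ρ) = ρ := by
  calc toState (toEffect ρ)
      = 𝟙 _ ⊗≫ (𝟙_ C ◁ cup A ≫ ρ ▷ ((ᘁA) ⊗ A)) ⊗≫ cap A ▷ A ⊗≫ 𝟙 _ := by
        simp only [toState, toEffect]; monoidal
    _ = ρ ⊗≫ (A ◁ cup A ⊗≫ cap A ▷ A) ⊗≫ 𝟙 _ := by
        rw [whisker_exchange]; monoidal
    _ = ρ := by
        rw [ExactPairing.coevaluation_evaluation'']; monoidal

theorem effectState_surj {A : C} (σ : 𝟙_ C ⟶ (ᘁA)) : ∃ x : A ⟶ 𝟙_ C, effectState x = σ := by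
  refine ⟨(ρ_ A).inv ≫ A ◁ σ ≫ cap A, ?_⟩
  calc effectState ((ρ_ A).inv ≫ A ◁ σ ≫ cap A)
      = 𝟙 _ ⊗≫ (cup A ▷ 𝟙_ C ≫ ((ᘁA) ⊗ A) ◁ σ) ⊗≫ (ᘁA) ◁ cap A ⊗≫ 𝟙 _ := by
        simp only [effectState]; monoidal
    _ = σ ⊗≫ (cup A ▷ (ᘁA) ⊗≫ (ᘁA) ◁ cap A) ⊗≫ 𝟙 _ := by
        rw [← whisker_exchange]; monoidal
    _ = σ := by
        rw [ExactPairing.evaluation_coevaluation'']; monoidal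

theorem effectState_scalar {A : C} (x : A ⟶ 𝟙_ C) (s : 𝟙_ C ⟶ 𝟙_ C) :
    effectState (x ≫ s) = s ≫ effectState x := by
  have h {B : C} (σ : 𝟙_ C ⟶ B) : s ≫ σ = σ ≫ (ρ_ B).inv ≫ B ◁ s ≫ (ρ_ B).hom := by
    rw [rightUnitor_inv_naturality_assoc, ← whisker_exchange_assoc,
      MonoidalCategory.rightUnitor_naturality, ← unitors_equal,
      MonoidalCategory.leftUnitor_naturality_assoc, ← unitors_inv_equal, Iso.inv_hom_id_assoc]
  rw [h]
  simp [effectState]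

theorem curry_effect {A X B : C} (f : A ⊗ X ⟶ B) (ρ : 𝟙_ C ⟶ X) (π : (ᘁA) ⟶ 𝟙_ C)
    (ξ : B ⟶ 𝟙_ C) :
    (ρ ≫ tensorLeftHomEquiv X (ᘁA) A B f) ≫ tensorEffect π ξ =
      (tensorState (toState π) ρ ≫ f) ≫ ξ := by
  change (ρ ≫ (λ_ _).inv ≫ cup A ▷ _ ≫ (α_ _ _ _).hom ≫ _ ◁ f) ≫ _ = _
  calc _ = 𝟙 _ ⊗≫ (𝟙_ C ◁ ρ ≫ cup A ▷ X) ⊗≫ ((ᘁA) ◁ (f ≫ ξ) ≫ π ▷ 𝟙_ C) ⊗≫ 𝟙 _ := by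
        simp only [tensorEffect, MonoidalCategory.tensorHom_def']; monoidal
    _ = 𝟙 _ ⊗≫ (cup A ▷ 𝟙_ C ≫ (((ᘁA) ⊗ A) ◁ ρ)) ⊗≫ (π ▷ (A ⊗ X) ≫ 𝟙_ C ◁ (f ≫ ξ)) ⊗≫ 𝟙 _ := by
        rw [whisker_exchange, whisker_exchange]
    _ = 𝟙 _ ⊗≫ cup A ▷ 𝟙_ C ⊗≫ ((ᘁA) ◁ (A ◁ ρ) ≫ π ▷ (A ⊗ X)) ⊗≫ (f ≫ ξ) ⊗≫ 𝟙 _ := by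
        monoidal
    _ = _ := by
        rw [whisker_exchange]
        simp only [tensorState, toState, MonoidalCategory.tensorHom_def]; monoidal

/-- The unit object `(I, {1})`. -/
@[reducible]
def unit : CausType C where
  X := 𝟙_ C
  states := {𝟙 _}
  closed := Set.Subset.antisymm
    (fun ρ hρ => by
      have := hρ (𝟙 _) (by rintro _ rfl; simp)
      simpa using this)
    (by rintro _ rfl π hπ; exact hπ _ rfl)
  flat_uniform := ⟨Iso.refl _, by simp [PrecausalCategory.uniform_unit]⟩
  flat_discard := ⟨Iso.refl _, by
    rintro _ rfl
    simp [discard, Discarding.discard_unit]⟩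

/-- The dual object `(A*, c*)`, effects being read as states of `A*`. -/
@[reducible]
def dual (A : CausType C) : CausType C where
  X := ᘁA.X
  states := effectState '' dualSet A.states
  closed := Set.Subset.antisymm
    (fun σ hσ => by
      obtain ⟨x, rfl⟩ := effectState_surj σ
      refine ⟨x, fun ρ hρ => ?_, rfl⟩
      have := hσ (toEffect ρ) (by
        rintro _ ⟨y, hy, rfl⟩
        rw [effectState_comp, toState_toEffect]
        exact hy ρ hρ)
      rwa [effectState_comp, toState_toEffect] at this)
    (fun _ hσ _ hπ => hπ _ hσ)
  flat_uniform := by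
    obtain ⟨s, hs⟩ := A.flat_discard
    refine ⟨s, discard A.X ≫ s.hom, hs, ?_⟩
    rw [PrecausalCategory.uniform_dual, effectState_scalar]
  flat_discard := by
    obtain ⟨s, hs⟩ := A.flat_uniform
    refine ⟨s, ?_⟩
    rintro _ ⟨π, hπ, rfl⟩
    have := hπ _ hs
    have h : toState (discard (ᘁA.X)) = uniform A.X := rfl
    rw [← Category.assoc, effectState_comp, h, scalar_comm, ← this, Category.assoc]

/-- The tensor product `(A ⊗ B, (c_A ⊗ c_B)**)`. -/
@[reducible]
def tensor (A B : CausType C) : CausType C where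
  X := A.X ⊗ B.X
  states := predualSet (dualSet (Set.image2 tensorState A.states B.states))
  closed := predual_dual_predual _
  flat_uniform := by
    obtain ⟨s, hs⟩ := A.flat_uniform
    obtain ⟨t, ht⟩ := B.flat_uniform
    refine ⟨s ≪≫ t, fun π hπ => ?_⟩
    have := hπ _ (Set.mem_image2_of_mem hs ht)
    rw [tensorState_scalar] at this
    rw [PrecausalCategory.uniform_tensor]
    exact this
  flat_discard := by
    obtain ⟨s, hs⟩ := A.flat_discard
    obtain ⟨t, ht⟩ := B.flat_discard
    refine ⟨s ≪≫ t, ?_⟩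
    rw [dual_predual_dual]
    rintro _ ⟨ρ, hρ, σ, hσ, rfl⟩
    have h : discard (A.X ⊗ B.X) = tensorEffect (discard A.X) (discard B.X) :=
      Discarding.discard_tensor _ _
    rw [h, Iso.trans_hom, ← tensorEffect_scalar, tensorState_effect, hs ρ hρ, ht σ hσ,
      Category.comp_id]

/-- The second tensor product `A & B = (A* ⊗ B*)*`, i.e. `(A ⊗ B, (c_A* ⊗ c_B*)*)`. -/
@[reducible]
def par (A B : CausType C) : CausType C where
  X := A.X ⊗ B.X
  states := predualSet (Set.image2 tensorEffect (dualSet A.states) (dualSet B.states))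
  closed := predual_dual_predual _
  flat_uniform := by
    obtain ⟨s, hs⟩ := A.flat_uniform
    obtain ⟨t, ht⟩ := B.flat_uniform
    refine ⟨s ≪≫ t, ?_⟩
    rintro _ ⟨π, hπ, ξ, hξ, rfl⟩
    have h : uniform (A.X ⊗ B.X) = tensorState (uniform A.X) (uniform B.X) :=
      PrecausalCategory.uniform_tensor _ _
    rw [h, Iso.trans_hom, ← tensorState_scalar, tensorState_effect, hπ _ hs, hξ _ ht,
      Category.comp_id]
  flat_discard := by
    obtain ⟨s, hs⟩ := A.flat_discard
    obtain ⟨t, ht⟩ := B.flat_discard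
    refine ⟨s ≪≫ t, fun ρ hρ => ?_⟩
    have h : discard (A.X ⊗ B.X) = tensorEffect (discard A.X) (discard B.X) :=
      Discarding.discard_tensor _ _
    rw [h, Iso.trans_hom, ← tensorEffect_scalar]
    exact hρ _ (Set.mem_image2_of_mem hs ht)

/-- The object of transformations `[A, B] = A* & B`. -/
@[reducible]
def hom (A B : CausType C) : CausType C := par (dual A) B

end CausType

namespace CausType
variable {C : Type u} [Category.{v} C] [MonoidalCategory C] [SymmetricCategory C]
  [LeftRigidCategory C] [PrecausalCategory C]

theorem mem_hom_iff {A B : CausType C} (w : 𝟙_ C ⟶ (hom A B).X) :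
    w ∈ (hom A B).states ↔ ∀ π : (ᘁA.X) ⟶ 𝟙_ C, toState π ∈ A.states →
      ∀ ξ ∈ dualSet B.states, w ≫ tensorEffect π ξ = 𝟙 (𝟙_ C) := by
  have key (π : (ᘁA.X) ⟶ 𝟙_ C) : π ∈ dualSet (dual A).states ↔ toState π ∈ A.states := by
    rw [← A.closed]
    constructor
    · intro h x hx
      rw [← effectState_comp]
      exact h _ ⟨x, hx, rfl⟩
    · rintro h _ ⟨x, hx, rfl⟩
      rw [effectState_comp]
      exact h x hx
  constructor
  · intro h π hπ ξ hξ
    exact h _ ⟨π, (key π).2 hπ, ξ, hξ, rfl⟩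
  · rintro h _ ⟨π, hπ, ξ, hξ, rfl⟩
    exact h π ((key π).1 hπ) ξ hξ

theorem tensorState_mem {A B : CausType C} {ρ : 𝟙_ C ⟶ A.X} {σ : 𝟙_ C ⟶ B.X}
    (hρ : ρ ∈ A.states) (hσ : σ ∈ B.states) : tensorState ρ σ ∈ (tensor A B).states :=
  fun _ hπ => hπ _ ⟨ρ, hρ, σ, hσ, rfl⟩

theorem preserves_of_tensor {A B E : CausType C} {f : A.X ⊗ B.X ⟶ E.X}
    (h : ∀ ρ ∈ A.states, ∀ σ ∈ B.states, tensorState ρ σ ≫ f ∈ E.states) :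
    Preserves (tensor A B) E f := by
  intro τ hτ
  rw [← E.closed]
  intro ξ hξ
  rw [Category.assoc]
  refine hτ _ ?_
  rintro _ ⟨ρ, hρ, σ, hσ, rfl⟩
  rw [← Category.assoc]
  exact hξ _ (h ρ hρ σ hσ)

theorem preserves_id (A : CausType C) : Preserves A A (𝟙 A.X) := fun ρ hρ => by
  rwa [Category.comp_id]

theorem preserves_comp {A B E : CausType C} {f : A.X ⟶ B.X} {g : B.X ⟶ E.X}
    (hf : Preserves A B f) (hg : Preserves B E g) : Preserves A E (f ≫ g) := fun ρ hρ => by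
  rw [← Category.assoc]; exact hg _ (hf _ hρ)

theorem preserves_tensor {A B A' B' : CausType C} {f : A.X ⟶ A'.X} {g : B.X ⟶ B'.X}
    (hf : Preserves A A' f) (hg : Preserves B B' g) :
    Preserves (tensor A B) (tensor A' B') (f ⊗ₘ g) :=
  preserves_of_tensor fun ρ hρ σ hσ => by
    rw [tensorState_tensor]; exact tensorState_mem (hf _ hρ) (hg _ hσ)

theorem tensorState_right {A B : C} (τ : 𝟙_ C ⟶ A) (σ : 𝟙_ C ⟶ B) :
    tensorState τ σ = τ ≫ (ρ_ A).inv ≫ A ◁ σ := by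
  rw [tensorState, MonoidalCategory.tensorHom_def, rightUnitor_inv_naturality_assoc,
    unitors_inv_equal]

theorem tensorState_left {A B : C} (τ : 𝟙_ C ⟶ A) (σ : 𝟙_ C ⟶ B) :
    tensorState τ σ = σ ≫ (λ_ B).inv ≫ τ ▷ B := by
  rw [tensorState, MonoidalCategory.tensorHom_def', leftUnitor_inv_naturality_assoc]

theorem tensorState_assoc {A B E : C} (ρ : 𝟙_ C ⟶ A) (σ : 𝟙_ C ⟶ B) (τ : 𝟙_ C ⟶ E) :
    tensorState (tensorState ρ σ) τ ≫ (α_ A B E).hom = tensorState ρ (tensorState σ τ) := by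
  simp only [tensorState, MonoidalCategory.tensorHom_def]
  monoidal

theorem preserves_assoc_hom (A B E : CausType C) :
    Preserves (tensor (tensor A B) E) (tensor A (tensor B E)) (α_ A.X B.X E.X).hom :=
  preserves_of_tensor fun τ hτ σ hσ => by
    rw [tensorState_right, Category.assoc]
    refine preserves_of_tensor (A := A) (B := B) (E := tensor A (tensor B E)) ?_ τ hτ
    intro ρ hρ ρ' hρ'
    have := tensorState_right (tensorState ρ ρ') σ
    rw [← Category.assoc, ← this, tensorState_assoc]
    exact tensorState_mem hρ (tensorState_mem hρ' hσ)

theorem preserves_assoc_inv (A B E : CausType C) :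
    Preserves (tensor A (tensor B E)) (tensor (tensor A B) E) (α_ A.X B.X E.X).inv :=
  preserves_of_tensor fun τ hτ σ hσ => by
    rw [tensorState_left, Category.assoc]
    refine preserves_of_tensor (A := B) (B := E) (E := tensor (tensor A B) E) ?_ σ hσ
    intro ρ hρ ρ' hρ'
    have := tensorState_left τ (tensorState ρ ρ')
    rw [← Category.assoc, ← this, ← tensorState_assoc, Category.assoc, Iso.hom_inv_id,
      Category.comp_id]
    exact tensorState_mem (tensorState_mem hτ hρ) hρ'

theorem preserves_left_hom (A : CausType C) : Preserves (tensor unit A) A (λ_ A.X).hom :=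
  preserves_of_tensor fun τ hτ σ hσ => by
    obtain rfl : τ = 𝟙 _ := hτ
    rw [tensorState_left]
    simpa using hσ

theorem preserves_left_inv (A : CausType C) : Preserves A (tensor unit A) (λ_ A.X).inv :=
  fun σ hσ => by
    have h := tensorState_mem (A := unit) (B := A) (ρ := 𝟙 _) rfl hσ
    rw [tensorState_left] at h
    simpa using h

theorem preserves_right_hom (A : CausType C) : Preserves (tensor A unit) A (ρ_ A.X).hom :=
  preserves_of_tensor fun τ hτ σ hσ => by
    obtain rfl : σ = 𝟙 _ := hσ
    rw [tensorState_right]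
    simpa using hτ

theorem preserves_right_inv (A : CausType C) : Preserves A (tensor A unit) (ρ_ A.X).inv :=
  fun σ hσ => by
    have h := tensorState_mem (A := A) (B := unit) (σ := 𝟙 _) hσ rfl
    rw [tensorState_right] at h
    simpa using h

theorem preserves_braiding (A B : CausType C) :
    Preserves (tensor A B) (tensor B A) (β_ A.X B.X).hom :=
  preserves_of_tensor fun τ hτ σ hσ => by
    have h : tensorState τ σ ≫ (β_ A.X B.X).hom = tensorState σ τ := by
      rw [tensorState, Category.assoc, BraidedCategory.braiding_naturality, ← Category.assoc,
        braiding_tensorUnit_right, ← unitors_equal, Iso.inv_hom_id_assoc]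
      rfl
    rw [h]
    exact tensorState_mem hσ hτ

theorem preserves_curry {A X B : CausType C} {f : A.X ⊗ X.X ⟶ B.X}
    (hf : Preserves (tensor A X) B f) :
    Preserves X (hom A B) (tensorLeftHomEquiv X.X (ᘁA.X) A.X B.X f) := fun ρ hρ => by
  rw [mem_hom_iff]
  intro π hπ ξ hξ
  rw [curry_effect]
  exact hξ _ (hf _ (tensorState_mem hπ hρ))

theorem preserves_uncurry {A X B : CausType C} {g : X.X ⟶ (hom A B).X}
    (hg : Preserves X (hom A B) g) :
    Preserves (tensor A X) B ((tensorLeftHomEquiv X.X (ᘁA.X) A.X B.X).symm g) :=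
  preserves_of_tensor fun ρ hρ σ hσ => by
    rw [← B.closed]
    intro ξ hξ
    have := curry_effect ((tensorLeftHomEquiv X.X (ᘁA.X) A.X B.X).symm g) σ (toEffect ρ) ξ
    rw [toState_toEffect, Equiv.apply_symm_apply] at this
    rw [← this]
    exact (mem_hom_iff _).1 (hg σ hσ) _ (by rwa [toState_toEffect]) ξ hξ

theorem preserves_hom_map (A : CausType C) {B B' : CausType C} {g : B.X ⟶ B'.X}
    (hg : Preserves B B' g) : Preserves (hom A B) (hom A B') ((ᘁA.X) ◁ g) := fun w hw => by
  rw [mem_hom_iff] at hw ⊢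
  intro π hπ ξ hξ
  have h : ((ᘁA.X) ◁ g) ≫ tensorEffect π ξ = tensorEffect π (g ≫ ξ) := by
    rw [tensorEffect, ← MonoidalCategory.id_tensorHom, tensorHom_comp_tensorHom_assoc,
      Category.id_comp, tensorEffect]
  rw [Category.assoc, h]
  refine hw π hπ _ fun σ hσ => ?_
  rw [← Category.assoc]
  exact hξ _ (hg σ hσ)

end CausType

namespace HomOrder
variable {C : Type u} [Category.{v} C] [MonoidalCategory C] (O : HomOrder C)

theorem whiskerLeft (A : C) {B B' : C} {f f' : B ⟶ B'} (h : O.le f f') :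
    O.le (A ◁ f) (A ◁ f') := by
  rw [← MonoidalCategory.id_tensorHom, ← MonoidalCategory.id_tensorHom]
  exact O.tensor (O.refl _) h

theorem whiskerRight (A : C) {B B' : C} {f f' : B ⟶ B'} (h : O.le f f') :
    O.le (f ▷ A) (f' ▷ A) := by
  rw [← MonoidalCategory.tensorHom_id, ← MonoidalCategory.tensorHom_id]
  exact O.tensor h (O.refl _)

end HomOrder

/-- The objects of `Caus_≤[C]` for an order `O`, which are those of `Caus[C]`. -/
def Caus {C : Type u} [Category.{v} C] [MonoidalCategory C] [SymmetricCategory C]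
    [LeftRigidCategory C] [PrecausalCategory C] (_O : HomOrder C) : Type (max u v) := CausType C

namespace Caus
variable {C : Type u} [Category.{v} C] [MonoidalCategory C] [SymmetricCategory C]
  [LeftRigidCategory C] [PrecausalCategory C] {O : HomOrder C}

/-- The morphisms of `Caus_≤[C]`: those morphisms of `C` that are below a morphism of `Caus[C]`. -/
@[ext]
structure Hom (A B : Caus O) where
  val : A.X ⟶ B.X
  property : ∃ f' : A.X ⟶ B.X, O.le val f' ∧ CausType.Preserves A B f'

instance : Category (Caus O) where
  Hom A B := Hom A B
  id A := ⟨𝟙 A.X, 𝟙 A.X, O.refl _, CausType.preserves_id A⟩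
  comp f g := ⟨f.val ≫ g.val, by
    obtain ⟨f', hf, pf⟩ := f.property
    obtain ⟨g', hg, pg⟩ := g.property
    exact ⟨f' ≫ g', O.comp hf hg, CausType.preserves_comp pf pg⟩⟩
  id_comp f := Hom.ext (Category.id_comp f.val)
  comp_id f := Hom.ext (Category.comp_id f.val)
  assoc f g h := Hom.ext (Category.assoc f.val g.val h.val)

variable (O) in
/-- The forgetful functor to `C`. -/
def forget : Caus O ⥤ C where
  obj A := A.X
  map f := f.val

instance : (forget O).Faithful where
  map_injective h := Hom.ext h

theorem hom_ext {A B : Caus O} {f g : A ⟶ B} (h : f.val = g.val) : f = g := Hom.ext h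

@[simp] theorem id_val (A : Caus O) : Hom.val (𝟙 A) = 𝟙 A.X := rfl
@[simp] theorem comp_val {A B E : Caus O} (f : A ⟶ B) (g : B ⟶ E) :
    Hom.val (f ≫ g) = f.val ≫ g.val := rfl

/-- A morphism of `Caus[C]` is a morphism of `Caus_≤[C]`. -/
def ofPreserves {A B : Caus O} (f : A.X ⟶ B.X) (hf : CausType.Preserves A B f) : A ⟶ B :=
  Hom.mk f ⟨f, O.refl f, hf⟩

/-- An isomorphism of `Caus[C]` is an isomorphism of `Caus_≤[C]`. -/
def isoOfPreserves {A B : Caus O} (e : A.X ≅ B.X) (h : CausType.Preserves A B e.hom)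
    (h' : CausType.Preserves B A e.inv) : A ≅ B where
  hom := ofPreserves e.hom h
  inv := ofPreserves e.inv h'
  hom_inv_id := Hom.ext e.hom_inv_id
  inv_hom_id := Hom.ext e.inv_hom_id

variable (O) in
instance : MonoidalCategoryStruct (Caus O) where
  tensorObj A B := CausType.tensor A B
  tensorUnit := CausType.unit
  whiskerLeft A _ _ f := Hom.mk (A.X ◁ f.val) (by
    obtain ⟨f', hf, pf⟩ := f.property
    refine ⟨A.X ◁ f', O.whiskerLeft _ hf, ?_⟩
    rw [← MonoidalCategory.id_tensorHom]
    exact CausType.preserves_tensor (CausType.preserves_id A) pf)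
  whiskerRight f B := Hom.mk (f.val ▷ B.X) (by
    obtain ⟨f', hf, pf⟩ := f.property
    refine ⟨f' ▷ B.X, O.whiskerRight _ hf, ?_⟩
    rw [← MonoidalCategory.tensorHom_id]
    exact CausType.preserves_tensor pf (CausType.preserves_id B))
  tensorHom f g := Hom.mk (f.val ⊗ₘ g.val) (by
    obtain ⟨f', hf, pf⟩ := f.property
    obtain ⟨g', hg, pg⟩ := g.property
    exact ⟨f' ⊗ₘ g', O.tensor hf hg, CausType.preserves_tensor pf pg⟩)
  associator A B E := isoOfPreserves (α_ A.X B.X E.X) (CausType.preserves_assoc_hom A B E)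
    (CausType.preserves_assoc_inv A B E)
  leftUnitor A := isoOfPreserves (λ_ A.X) (CausType.preserves_left_hom A)
    (CausType.preserves_left_inv A)
  rightUnitor A := isoOfPreserves (ρ_ A.X) (CausType.preserves_right_hom A)
    (CausType.preserves_right_inv A)

instance : MonoidalCategory (Caus O) where
  tensorHom_def _ _ := hom_ext (MonoidalCategory.tensorHom_def _ _)
  id_tensorHom_id _ _ := hom_ext (MonoidalCategory.id_tensorHom_id _ _)
  tensorHom_comp_tensorHom _ _ _ _ := hom_ext (MonoidalCategory.tensorHom_comp_tensorHom _ _ _ _)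
  whiskerLeft_id _ _ := hom_ext (MonoidalCategory.whiskerLeft_id _ _)
  id_whiskerRight _ _ := hom_ext (MonoidalCategory.id_whiskerRight _ _)
  associator_naturality _ _ _ := hom_ext (MonoidalCategory.associator_naturality _ _ _)
  leftUnitor_naturality _ := hom_ext (MonoidalCategory.leftUnitor_naturality _)
  rightUnitor_naturality _ := hom_ext (MonoidalCategory.rightUnitor_naturality _)
  pentagon _ _ _ _ := hom_ext (MonoidalCategory.pentagon _ _ _ _)
  triangle _ _ := hom_ext (MonoidalCategory.triangle _ _)

instance : SymmetricCategory (Caus O) where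
  braiding A B := isoOfPreserves (β_ A.X B.X) (CausType.preserves_braiding A B) (by
    have := CausType.preserves_braiding B A
    rwa [SymmetricCategory.braiding_swap_eq_inv_braiding A.X B.X] at this)
  braiding_naturality_right _ _ _ _ := hom_ext (BraidedCategory.braiding_naturality_right _ _)
  braiding_naturality_left _ _ := hom_ext (BraidedCategory.braiding_naturality_left _ _)
  hexagon_forward _ _ _ := hom_ext (BraidedCategory.hexagon_forward _ _ _)
  hexagon_reverse _ _ _ := hom_ext (BraidedCategory.hexagon_reverse _ _ _)
  symmetry _ _ := hom_ext (SymmetricCategory.symmetry _ _)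

/-- The internal hom functor `[A, -]`. -/
def ihomFunctor (A : Caus O) : Caus O ⥤ Caus O where
  obj B := CausType.hom A B
  map g := Hom.mk ((ᘁA.X) ◁ g.val) (by
    obtain ⟨g', hg, pg⟩ := g.property
    exact ⟨(ᘁA.X) ◁ g', O.whiskerLeft _ hg, CausType.preserves_hom_map A pg⟩)
  map_id _ := hom_ext (MonoidalCategory.whiskerLeft_id _ _)
  map_comp _ _ := hom_ext (MonoidalCategory.whiskerLeft_comp _ _ _)

/-- Currying, given by the compact structure of `C`. -/
def ihomEquiv (A X B : Caus O) : (A ⊗ X ⟶ B) ≃ (X ⟶ (ihomFunctor A).obj B) where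
  toFun f := Hom.mk (tensorLeftHomEquiv X.X (ᘁA.X) A.X B.X f.val) (by
    obtain ⟨f', hf, pf⟩ := f.property
    exact ⟨tensorLeftHomEquiv X.X (ᘁA.X) A.X B.X f',
      O.comp (O.refl _) (O.comp (O.refl _) (O.comp (O.refl _) (O.whiskerLeft _ hf))),
      CausType.preserves_curry pf⟩)
  invFun g := Hom.mk ((tensorLeftHomEquiv X.X (ᘁA.X) A.X B.X).symm g.val) (by
    obtain ⟨g', hg, pg⟩ := g.property
    exact ⟨(tensorLeftHomEquiv X.X (ᘁA.X) A.X B.X).symm g',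
      O.comp (O.whiskerLeft _ hg) (O.refl _),
      CausType.preserves_uncurry pg⟩)
  left_inv f := hom_ext ((tensorLeftHomEquiv X.X (ᘁA.X) A.X B.X).left_inv f.val)
  right_inv g := hom_ext ((tensorLeftHomEquiv X.X (ᘁA.X) A.X B.X).right_inv g.val)

instance : MonoidalClosed (Caus O) where
  closed A :=
    { rightAdj := ihomFunctor A
      adj := Adjunction.mkOfHomEquiv
        { homEquiv := ihomEquiv A
          homEquiv_naturality_left_symm f g :=
            hom_ext (tensorLeftHomEquiv_symm_naturality f.val g.val)
          homEquiv_naturality_right f g := hom_ext (tensorLeftHomEquiv_naturality f.val g.val) } }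

end Caus


section Layers
variable {C : Type u} [Category.{v} C] [MonoidalCategory C] [SymmetricCategory C]
  [LeftRigidCategory C] [PrecausalCategory C]

/-- For the discrete order, `Caus_=[C]` is `Caus[C]`: its morphisms are those preserving states. -/
theorem Caus.exists_hom_discrete_iff {A B : Caus (HomOrder.discrete C)} (f : A.X ⟶ B.X) :
    (∃ g : A ⟶ B, Caus.Hom.val g = f) ↔ CausType.Preserves A B f := by
  constructor
  · rintro ⟨⟨_, f', h, hf⟩, rfl⟩
    obtain rfl : _ = f' := h
    exact hf
  · exact fun h => ⟨Caus.ofPreserves f h, rfl⟩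

/-- First-order objects: the states are exactly the causal ones. -/
def FirstOrder (A : CausType C) : Prop := A.states = {ρ | IsCausal ρ}

theorem isCausal_iff {A : C} (ρ : 𝟙_ C ⟶ A) : IsCausal ρ ↔ ρ ≫ discard A = 𝟙 (𝟙_ C) := by
  rw [IsCausal, show discard (𝟙_ C) = 𝟙 _ from Discarding.discard_unit]

theorem FirstOrder.unit : FirstOrder (CausType.unit : CausType C) := by
  ext ρ
  rw [Set.mem_ofPred_eq, isCausal_iff, discard, Discarding.discard_unit, Category.comp_id]
  rfl

theorem FirstOrder.tensor {A B : CausType C} (hA : FirstOrder A) (hB : FirstOrder B) :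
    FirstOrder (CausType.tensor A B) := by
  have hd : discard (A.X ⊗ B.X) = tensorEffect (discard A.X) (discard B.X) :=
    Discarding.discard_tensor _ _
  have hmem : discard (A.X ⊗ B.X) ∈ dualSet (Set.image2 tensorState A.states B.states) := by
    rintro _ ⟨ρ, hρ, σ, hσ, rfl⟩
    rw [hA] at hρ
    rw [hB] at hσ
    rw [hd, CausType.tensorState_effect, (isCausal_iff ρ).1 hρ, (isCausal_iff σ).1 hσ,
      Category.comp_id]
  have key (π : A.X ⊗ B.X ⟶ 𝟙_ C)
      (hπ : π ∈ dualSet (Set.image2 tensorState A.states B.states)) :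
      π = discard (A.X ⊗ B.X) := by
    have h (σ : 𝟙_ C ⟶ B.X) (hσ : IsCausal σ) :
        A.X ◁ σ ≫ π = A.X ◁ σ ≫ discard (A.X ⊗ B.X) := by
      rw [← cancel_epi (ρ_ A.X).inv]
      refine PrecausalCategory.enough_causal_states _ _ fun ρ hρ => ?_
      have hm : tensorState ρ σ ∈ Set.image2 tensorState A.states B.states :=
        ⟨ρ, by rw [hA]; exact hρ, σ, by rw [hB]; exact hσ, rfl⟩
      have e1 := hπ _ hm
      have e2 := hmem _ hm
      rw [CausType.tensorState_right] at e1 e2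
      simp only [Category.assoc] at e1 e2
      rw [e1, e2]
    apply (tensorLeftHomEquiv B.X (ᘁA.X) A.X (𝟙_ C)).injective
    refine PrecausalCategory.enough_causal_states _ _ fun σ hσ => ?_
    apply (tensorLeftHomEquiv (𝟙_ C) (ᘁA.X) A.X (𝟙_ C)).symm.injective
    rw [tensorLeftHomEquiv_symm_naturality, tensorLeftHomEquiv_symm_naturality,
      Equiv.symm_apply_apply, Equiv.symm_apply_apply, h σ hσ]
  ext τ
  rw [Set.mem_ofPred_eq, isCausal_iff]
  constructor
  · exact fun h => h _ hmem
  · intro h π hπ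
    rw [key π hπ, h]

variable (O : HomOrder C)

/-- The objects generated from the `[A, B]`, with `A` and `B` in the class `P`, by `⊗` and `&`. -/
inductive HomClosure (P : ObjectProperty (Caus O)) : ObjectProperty (Caus O)
  | hom {A B : Caus O} : P A → P B → HomClosure P (CausType.hom A B : Caus O)
  | tensor {A B : Caus O} : HomClosure P A → HomClosure P B →
      HomClosure P (CausType.tensor A B : Caus O)
  | par {A B : Caus O} : HomClosure P A → HomClosure P B →
      HomClosure P (CausType.par A B : Caus O)

/-- If `J ≅ I` then `[J, J] ≅ I`, canonically. -/
def ihomUnitIso {D : Type u} [Category.{v} D] [MonoidalCategory D] [MonoidalClosed D]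
    {J : D} (e : J ≅ 𝟙_ D) : (ihom J).obj J ≅ 𝟙_ D :=
  (ihom J).mapIso e ≪≫ (MonoidalClosed.internalHom.mapIso e.symm.op).app (𝟙_ D) ≪≫
    (MonoidalClosed.unitNatIso.app (𝟙_ D)).symm

/-- The objects of the layers: `layer O n` is the class of objects of the layer `[C]^{n+1}`. It starts
with the first-order objects; the next class is generated from the `[A, B]` with `A`, `B` in the
previous one. The units are `I`, `[I, I]`, and so on. -/
def layer : ℕ → SubSMC (Caus O)
  | 0 =>
    { P := fun A => FirstOrder (A : CausType C)
      tensor_mem := FirstOrder.tensor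
      unit := 𝟙_ (Caus O)
      unit_mem := FirstOrder.unit
      unitIso := Iso.refl _ }
  | n + 1 =>
    { P := HomClosure O (layer n).P
      tensor_mem := HomClosure.tensor
      unit := (ihom (layer n).unit).obj (layer n).unit
      unit_mem := HomClosure.hom (layer n).unit_mem (layer n).unit_mem
      unitIso := ihomUnitIso (layer n).unitIso }

/-- `Layer O n` is the layer of order `n + 1`: a full symmetric monoidal subcategory of
`Caus_≤[C]`. For the discrete order it is the layer `[C]^{n+1}` of `Caus[C]`. -/
abbrev Layer (n : ℕ) : Type (max u v) := (layer O n).Cat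

/-- The layer of order `n + 1` is a symmetric monoidal category enriched in the layer of order
`n + 2`. -/
instance (n : ℕ) : EnrichedSMC (Layer O (n + 1)) (Layer O n) :=
  SubSMC.enrichedSMC fun _ _ hA hB => HomClosure.hom hA hB

end Layers

end HigherOrder

open HigherOrder

/-! The argument lives in an arbitrary closed symmetric monoidal category `D` with three classes of
objects `S`, `T`, `W`, each closed under tensor products and containing a copy of the unit, such
that internal homs of objects of `S` lie in `T` and those of objects of `T` lie in `W`. For the
theorem, `D` is `Caus O` and the classes are three consecutive layers.

Raising changes nothing up to isomorphism. If `J ≅ I`, evaluation at the point of `J` is an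
isomorphism `lower : [J, A] ⟶ A`, natural in `A` (`isIso_lower`, `ihom_map_lower`). It turns the
canonical comparison morphisms of `[J, -]` into the identification of the two units and into the
tensor product of two lowerings (`curry'_lower`, `tens_lower`). The raising functor is thus the
inclusion into `D` in disguise: each axiom of a braided monoidal functor may be tested after
lowering, where it is naturality of a structural isomorphism of `D`, and the comparison morphisms
are invertible for the same reason (`exists_braided`).

Under these identifications `γ` is the identity of `[A, B]`: composing a raised element of `A` with
an inserted function and then evaluating at the point applies the function to the element
(`comp_lower`, `insertion_lower`). `Represents` expresses this through evaluations, and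
`represents_gamma` proves it for `γ`. A morphism into an internal hom is determined by its
evaluation, also after lowering the output, since lowering is mono. So the laws for states,
sequential composition and parallel composition follow by comparing evaluations (`Represents.state`,
`Represents.comp`, `Represents.tens`). -/

namespace HigherOrder
set_option linter.unusedSectionVars false

/-! ### Evaluation at the point of an object isomorphic to the unit. -/

section Lower
variable {D : Type u} [Category.{v} D] [MonoidalCategory D] [SymmetricCategory D]
  [MonoidalClosed D]
open MonoidalClosed

/-- For `J ≅ I`, the canonical morphism `[J, A] ⟶ A`: evaluation at the point of `J`. -/
def lower {J : D} (e : J ≅ 𝟙_ D) (A : D) : (ihom J).obj A ⟶ A :=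
  (λ_ _).inv ≫ e.inv ▷ _ ≫ evl J A

variable {J : D} (e : J ≅ 𝟙_ D)

/-- Since `J` is a copy of the unit, its point is its only input: `lower` determines the whole
evaluation. -/
theorem evl_eq_lower (A : D) :
    evl J A = e.hom ▷ _ ≫ (λ_ _).hom ≫ lower e A := by
  rw [lower, Iso.hom_inv_id_assoc, ← comp_whiskerRight_assoc, Iso.hom_inv_id,
    MonoidalCategory.id_whiskerRight, Category.id_comp]

/-- The inverse is the transpose of `J ⊗ A ≅ I ⊗ A ≅ A`, which sends an element to the constant
function. One composite is a computation; the other is compared after evaluation, which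
`evl_eq_lower` reduces to the first. -/
instance isIso_lower (A : D) : IsIso (lower e A) := by
  have h : curry (e.hom ▷ A ≫ (λ_ A).hom) ≫ lower e A = 𝟙 A := by
    rw [lower, leftUnitor_inv_naturality_assoc, whisker_exchange_assoc, ← uncurry_eq,
      uncurry_curry, ← comp_whiskerRight_assoc, Iso.inv_hom_id,
      MonoidalCategory.id_whiskerRight, Category.id_comp, Iso.inv_hom_id]
  refine ⟨curry (e.hom ▷ A ≫ (λ_ A).hom), hom_ext' ?_, h⟩
  rw [evl_eq_lower e, whisker_exchange_assoc, MonoidalCategory.leftUnitor_naturality_assoc,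
    Category.assoc, h, MonoidalCategory.whiskerLeft_id, Category.id_comp, Category.comp_id]

theorem ihom_map_lower {A B : D} (f : A ⟶ B) :
    (ihom J).map f ≫ lower e B = lower e A ≫ f := by
  rw [lower, leftUnitor_inv_naturality_assoc, whisker_exchange_assoc, map_ev, lower]
  simp only [Category.assoc]

/-- For `f = 𝟙 J` this computes the unit comparison of the raising functor. -/
theorem curry'_lower {A : D} (f : J ⟶ A) : curry' f ≫ lower e A = e.inv ≫ f := by
  rw [lower, leftUnitor_inv_naturality_assoc, whisker_exchange_assoc, curry'_ev,
    MonoidalCategory.rightUnitor_naturality_assoc, ← unitors_equal, Iso.inv_hom_id_assoc]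

/-- The value of a composite at the point is the second function applied to the value of the first.
This is how `γ`, built from composition, becomes evaluation. -/
theorem comp_lower (A B : D) :
    MonoidalClosed.comp J A B ≫ lower e B = lower e A ▷ _ ≫ evl A B := by
  rw [lower, leftUnitor_inv_naturality_assoc, whisker_exchange_assoc, comp_ev, lower]
  simp only [comp_whiskerRight, Category.assoc, associator_inv_naturality_left_assoc]
  monoidal

/-- The precomposed map `J ⟶ J ⊗ J` is the inverse left unitor of `J` regarded as the unit of a
subcategory. It sends the point to the pair of points, so a product of functions is evaluated at the
point in each factor. -/
theorem tens_lower (A B : D) :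
    tens J A J B ≫ (pre ((λ_ J).inv ≫ e.inv ▷ J)).app (A ⊗ B) ≫ lower e (A ⊗ B) =
      lower e A ⊗ₘ lower e B := by
  have h : e.inv ≫ (λ_ J).inv ≫ e.inv ▷ J = (λ_ (𝟙_ D)).inv ≫ (e.inv ⊗ₘ e.inv) := by
    rw [leftUnitor_inv_naturality_assoc, ← MonoidalCategory.tensorHom_def']
  -- Solved for inverses, this splits the unit beside a tensor product into one unit beside each
  -- factor, as needed to separate the two lowerings.
  have h' := tensor_left_unitality ((ihom J).obj A) ((ihom J).obj B)
  rw [← cancel_mono ((λ_ ((ihom J).obj A)).inv ⊗ₘ (λ_ ((ihom J).obj B)).inv)]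
    at h'
  simp only [Category.assoc, tensorHom_comp_tensorHom, Iso.hom_inv_id,
    MonoidalCategory.id_tensorHom_id, Category.comp_id] at h'
  rw [lower, leftUnitor_inv_naturality_assoc, whisker_exchange_assoc, pre_ev,
    leftUnitor_inv_naturality_assoc, whisker_exchange_assoc, whisker_exchange_assoc, tens_ev,
    ← comp_whiskerRight_assoc, h, comp_whiskerRight_assoc, tensorμ_natural_left_assoc,
    ← reassoc_of% h', Iso.inv_hom_id_assoc, lower, lower, tensorHom_comp_tensorHom,
    tensorHom_comp_tensorHom]

/-- Tensoring with `curry' (𝟙 X)` on the left sends a function to itself, acting beside `X`. -/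
theorem id_tens_ev (X K H : D) :
    (X ⊗ K) ◁ ((λ_ ((ihom K).obj H)).inv ≫ curry' (𝟙 X) ▷ _ ≫ tens X X K H) ≫
        evl (X ⊗ K) (X ⊗ H) = (α_ _ _ _).hom ≫ X ◁ evl K H := by
  simp only [MonoidalCategory.whiskerLeft_comp, Category.assoc, tens_ev]
  rw [← MonoidalCategory.tensorHom_id (curry' (𝟙 X)), tensorμ_natural_right_assoc,
    tensorHom_comp_tensorHom, curry'_ev, MonoidalCategory.whiskerLeft_id, Category.id_comp,
    Category.comp_id, MonoidalCategory.tensorHom_def (ρ_ X).hom]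
  -- Interchanging `K` with a unit is trivial, so only reassociation remains.
  have : (X ⊗ K) ◁ (λ_ ((ihom K).obj H)).inv ≫ tensorμ X K (𝟙_ D) ((ihom K).obj H) ≫
      (ρ_ X).hom ▷ _ = (α_ _ _ _).hom := by
    simp only [tensorμ]; simp; monoidal
  rw [reassoc_of% this]

/-- For `J, K ≅ I`, the morphism `[K, [A, B]] ⟶ [[J, A], [J, B]]` that inserts a function into
composition acts as evaluation of `[A, B]` on `A`. -/
theorem insertion_lower {K : D} (k : K ≅ 𝟙_ D) (A B : D) :
    (ihom J).obj A ◁ (((λ_ _).inv ≫ curry' (𝟙 ((ihom J).obj A)) ▷ _ ≫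
        tens ((ihom J).obj A) ((ihom J).obj A) K ((ihom A).obj B)) ≫
      (ihom _).map (MonoidalClosed.comp J A B) ≫
        (pre ((ρ_ _).inv ≫ _ ◁ k.inv)).app _) ≫ evl _ _ ≫ lower e B =
      (lower e A ⊗ₘ lower k ((ihom A).obj B)) ≫ evl A B := by
  have h := id_tens_ev ((ihom J).obj A) K ((ihom A).obj B)
  -- Only the evaluation law `h` of this morphism matters from here on.
  generalize (λ_ _).inv ≫ curry' (𝟙 ((ihom J).obj A)) ▷ _ ≫
    tens ((ihom J).obj A) ((ihom J).obj A) K ((ihom A).obj B) = i at h ⊢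
  rw [MonoidalCategory.whiskerLeft_comp_assoc, MonoidalCategory.whiskerLeft_comp_assoc,
    reassoc_of% pre_ev ((ρ_ ((ihom J).obj A)).inv ≫ _ ◁ k.inv), whisker_exchange_assoc,
    whisker_exchange_assoc, reassoc_of% map_ev (MonoidalClosed.comp J A B),
    reassoc_of% h, comp_lower, MonoidalCategory.tensorHom_def', Category.assoc,
    lower.eq_1 k, MonoidalCategory.whiskerLeft_comp_assoc,
    MonoidalCategory.whiskerLeft_comp_assoc]
  simp

/-- The left side is the shape of `γ` in a subcategory whose unit is `L`. Each inserted state enters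
through `w.hom` and its unitor through `w.inv`; these cancel, and composing with the state of `f` is
postcomposition with `f`. -/
theorem insertion_eq {X K H Z L : D} (w : L ≅ 𝟙_ D) (f : X ⊗ H ⟶ Z) (n : X ⟶ X ⊗ K) :
    ((ρ_ _).inv ≫ _ ◁ w.inv) ≫ _ ◁ (w.hom ≫ curry' f) ≫
      ((((λ_ _).inv ≫ w.inv ▷ _) ≫ (w.hom ≫ curry' (𝟙 X)) ▷ _ ≫ tens X X K H) ▷ _ ≫
        MonoidalClosed.comp _ _ _) ≫ (pre n).app Z =
    ((λ_ _).inv ≫ curry' (𝟙 X) ▷ _ ≫ tens X X K H) ≫ (ihom _).map f ≫ (pre n).app Z := by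
  simp only [Category.assoc, ← comp_whiskerRight_assoc, Iso.inv_hom_id_assoc,
    ← MonoidalCategory.whiskerLeft_comp_assoc]
  rw [whisker_exchange_assoc, reassoc_of% MonoidalClosed.whiskerLeft_curry'_comp,
    ← rightUnitor_inv_naturality_assoc, Iso.inv_hom_id_assoc]
  simp only [Category.assoc]

end Lower

/-! ### Transporting a braided monoidal structure along an isomorphism with the inclusion. -/

namespace SubSMC

section Basic
variable {D : Type u} [Category.{v} D] [MonoidalCategory D]
  {S T : SubSMC D}

variable (S) in
/-- The unit object of the subcategory is isomorphic to that of the ambient category. -/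
def objUnitIso : obj (𝟙_ S.Cat) ≅ 𝟙_ D := S.unitIso

theorem isIso_of_dn {A B : S.Cat} (f : A ⟶ B) (hf : IsIso (dn f)) : IsIso f :=
  ⟨lift (inv (dn f)), hom_ext (IsIso.hom_inv_id (dn f)), hom_ext (IsIso.inv_hom_id (dn f))⟩

theorem hom_ext_of_mono {A : T.Cat} {B : D} {X : T.Cat} {f g : X ⟶ A} (p : obj A ⟶ B) [Mono p]
    (h : dn f ≫ p = dn g ≫ p) : f = g :=
  hom_ext ((cancel_mono p).1 h)

end Basic

section Comparison
variable {D : Type u} [Category.{v} D] [MonoidalCategory D]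

/-- What the associativity axiom of a monoidal functor becomes after lowering: `m`, `n` are
comparison morphisms, the other letters lowerings. The hypotheses reduce it to naturality of the
associator. -/
theorem tensor_assoc_of_comp {X Y Z X' Y' Z' P Q : D} {x : X' ⟶ X} {y : Y' ⟶ Y} {z : Z' ⟶ Z}
    {m : X' ⊗ Y' ⟶ P} {p : P ⟶ X ⊗ Y} {n : Y' ⊗ Z' ⟶ Q} {q : Q ⟶ Y ⊗ Z}
    (hp : m ≫ p = x ⊗ₘ y) (hq : n ≫ q = y ⊗ₘ z) :
    m ▷ Z' ≫ (p ⊗ₘ z) ≫ (α_ X Y Z).hom = (α_ X' Y' Z').hom ≫ X' ◁ n ≫ (x ⊗ₘ q) := by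
  rw [← MonoidalCategory.tensorHom_id, ← MonoidalCategory.id_tensorHom,
    tensorHom_comp_tensorHom_assoc, tensorHom_comp_tensorHom, Category.id_comp, Category.id_comp,
    hp, hq, MonoidalCategory.associator_naturality]

/-- The left unit axiom after lowering: `J` and `J'` play the units of source and target, `r` the
unit comparison, and `hr` says that `r` lowers to the canonical `J' ≅ J`. -/
theorem leftUnitor_of_comp {J J' U X X' : D} (j : J ≅ 𝟙_ D) (j' : J' ≅ 𝟙_ D) {r : J' ⟶ U}
    {p : U ⟶ J} (hr : r ≫ p = j'.hom ≫ j.inv) (x : X' ⟶ X) :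
    (j'.hom ▷ X' ≫ (λ_ X').hom) ≫ x =
      r ▷ X' ≫ (p ⊗ₘ x) ≫ j.hom ▷ X ≫ (λ_ X).hom := by
  rw [← MonoidalCategory.tensorHom_id r, tensorHom_comp_tensorHom_assoc, hr,
    ← MonoidalCategory.tensorHom_id j.hom, tensorHom_comp_tensorHom_assoc]
  simp [MonoidalCategory.tensorHom_def]

theorem rightUnitor_of_comp {J J' U X X' : D} (j : J ≅ 𝟙_ D) (j' : J' ≅ 𝟙_ D) {r : J' ⟶ U}
    {p : U ⟶ J} (hr : r ≫ p = j'.hom ≫ j.inv) (x : X' ⟶ X) :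
    (X' ◁ j'.hom ≫ (ρ_ X').hom) ≫ x =
      X' ◁ r ≫ (x ⊗ₘ p) ≫ X ◁ j.hom ≫ (ρ_ X).hom := by
  rw [← MonoidalCategory.id_tensorHom _ r, tensorHom_comp_tensorHom_assoc, hr,
    ← MonoidalCategory.id_tensorHom _ j.hom, tensorHom_comp_tensorHom_assoc]
  simp [MonoidalCategory.tensorHom_def']

end Comparison

section Reflection
variable {D : Type u} [Category.{v} D] [MonoidalCategory D] [SymmetricCategory D]
  {S T : SubSMC D} (F : S.Cat ⥤ T.Cat) (l : ∀ A, obj (F.obj A) ⟶ obj A) [∀ A, IsIso (l A)]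
  (hl : ∀ {A B : S.Cat} (f : A ⟶ B), dn (F.map f) ≫ l B = l A ≫ dn f)
  (r : 𝟙_ T.Cat ⟶ F.obj (𝟙_ S.Cat))
  (hr : dn r ≫ l (𝟙_ S.Cat) = T.objUnitIso.hom ≫ S.objUnitIso.inv)
  (m : ∀ A B, F.obj A ⊗ F.obj B ⟶ F.obj (A ⊗ B)) (hm : ∀ A B, dn (m A B) ≫ l (A ⊗ B) = l A ⊗ₘ l B)
include hl hr hm

/-- A functor between `SubSMC`s naturally isomorphic, in the ambient category, to the inclusion is
braided monoidal, for comparison morphisms that this isomorphism carries to identities. -/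
theorem exists_braided : ∃ _ : F.Braided, Functor.LaxMonoidal.ε F = r ∧
    ∀ A B, Functor.LaxMonoidal.μ F A B = m A B := by
  -- Invertibility of the comparison morphisms is read off after composing with the isomorphism `l`,
  -- and transfers back because the subcategory is full.
  have : IsIso r := isIso_of_dn r <| by
    have : IsIso (dn r ≫ l (𝟙_ S.Cat)) := by rw [hr]; infer_instance
    exact IsIso.of_isIso_comp_right (dn r) (l (𝟙_ S.Cat))
  have (A B : S.Cat) : IsIso (m A B) := isIso_of_dn _ <| by
    have : IsIso (dn (m A B) ≫ l (A ⊗ B)) := by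
      rw [hm]
      exact inferInstanceAs (IsIso (MonoidalCategory.tensorHom (l A) (l B)))
    exact IsIso.of_isIso_comp_right (dn (m A B)) (l (A ⊗ B))
  -- Each axiom is composed with the mono `l` at its target; `hm`, `hl` and `hr` then remove every
  -- comparison morphism and every `F.map`.
  let c : F.CoreMonoidal :=
    { εIso := asIso r
      μIso A B := asIso (m A B)
      μIso_hom_natural_left {X Y} f Z := hom_ext_of_mono (l (Y ⊗ Z)) <| by
        simp only [asIso_hom, dn_comp, Category.assoc, hm, hl, reassoc_of% hm]
        change dn (F.map f) ▷ obj (F.obj Z) ≫ (l Y ⊗ₘ l Z) = (l X ⊗ₘ l Z) ≫ dn f ▷ obj Z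
        rw [← MonoidalCategory.tensorHom_id, ← MonoidalCategory.tensorHom_id,
          tensorHom_comp_tensorHom, tensorHom_comp_tensorHom, hl, Category.id_comp,
          Category.comp_id]
      μIso_hom_natural_right {X Y} Z f := hom_ext_of_mono (l (Z ⊗ Y)) <| by
        simp only [asIso_hom, dn_comp, Category.assoc, hm, hl, reassoc_of% hm]
        change obj (F.obj Z) ◁ dn (F.map f) ≫ (l Z ⊗ₘ l Y) = (l Z ⊗ₘ l X) ≫ obj Z ◁ dn f
        rw [← MonoidalCategory.id_tensorHom, ← MonoidalCategory.id_tensorHom,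
          tensorHom_comp_tensorHom, tensorHom_comp_tensorHom, hl, Category.id_comp,
          Category.comp_id]
      associativity X Y Z := hom_ext_of_mono (l (X ⊗ Y ⊗ Z)) <| by
        simp only [asIso_hom, dn_comp, Category.assoc, hm, hl, reassoc_of% hm]
        exact tensor_assoc_of_comp (hm X Y) (hm Y Z)
      left_unitality X := hom_ext_of_mono (l X) <| by
        simp only [asIso_hom, dn_comp, Category.assoc, hl, reassoc_of% hm]
        exact leftUnitor_of_comp _ _ hr (l X)
      right_unitality X := hom_ext_of_mono (l X) <| by
        simp only [asIso_hom, dn_comp, Category.assoc, hl, reassoc_of% hm]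
        exact rightUnitor_of_comp _ _ hr (l X) }
  let _ := c.toMonoidal
  exact ⟨{ braided X Y := hom_ext_of_mono (l (Y ⊗ X)) <| by
            have (A B : S.Cat) : Functor.LaxMonoidal.μ F A B = m A B := rfl
            simp only [this, dn_comp, Category.assoc, hm, hl, reassoc_of% hm]
            exact BraidedCategory.braiding_naturality (l X) (l Y) }, rfl, fun _ _ => rfl⟩

end Reflection
end SubSMC

/-! ### Morphisms into internal homs compared through their evaluations. -/

section Represents
variable {D : Type u} [Category.{v} D] [MonoidalCategory D] [SymmetricCategory D]
  [MonoidalClosed D]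
open MonoidalClosed

/-- Applying `g` and then `b` is applying `p` to the image of the input under `a`. -/
def Represents {A A₁ B B₁ P : D} (a : A₁ ⟶ A) (b : B₁ ⟶ B) (p : P ⟶ (ihom A).obj B)
    (g : P ⟶ (ihom A₁).obj B₁) : Prop :=
  A₁ ◁ g ≫ evl A₁ B₁ ≫ b = (a ⊗ₘ p) ≫ evl A B

variable {A A₁ B B₁ E E₁ A' A'₁ B' B'₁ P Q R L : D} {a : A₁ ⟶ A} {b : B₁ ⟶ B} {c : E₁ ⟶ E}
  {a' : A'₁ ⟶ A'} {b' : B'₁ ⟶ B'}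

theorem hom_ext_of_mono {X : D} (b : B₁ ⟶ B) [Mono b] {f g : X ⟶ (ihom A).obj B₁}
    (h : A ◁ f ≫ evl A B₁ ≫ b = A ◁ g ≫ evl A B₁ ≫ b) : f = g :=
  hom_ext' ((cancel_mono b).1 (by simpa only [Category.assoc] using h))

/-- Both sides, evaluated and followed by `b`, apply `a` and then `f`. The map `t` is there for the
unit of the enriching subcategory, which is only isomorphic to `𝟙_ D`. -/
theorem Represents.state {p : P ⟶ (ihom A).obj B} {g : P ⟶ (ihom A₁).obj B₁}
    (hg : Represents a b p g) (hb : Mono b) {f : A ⟶ B} {f₁ : A₁ ⟶ B₁}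
    (hf : f₁ ≫ b = a ≫ f) {t : L ⟶ 𝟙_ D} {s : L ⟶ P} (hs : s ≫ p = t ≫ curry' f) : t ≫ curry' f₁ = s ≫ g := by
  apply hom_ext_of_mono b
  rw [MonoidalCategory.whiskerLeft_comp_assoc, reassoc_of% curry'_ev f₁,
    MonoidalCategory.whiskerLeft_comp_assoc, hg, MonoidalCategory.tensorHom_def',
    Category.assoc, ← MonoidalCategory.whiskerLeft_comp_assoc, hs, hf,
    whisker_exchange_assoc, MonoidalCategory.whiskerLeft_comp_assoc, curry'_ev,
    ← whisker_exchange_assoc, MonoidalCategory.rightUnitor_naturality_assoc]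

/-- Both sides, evaluated and followed by `c`, apply `p` and then `q` to the image under `a`. The
two representations chain because `b` is the output map of the first and the input map of the
second. -/
theorem Represents.comp {p : P ⟶ (ihom A).obj B} {g : P ⟶ (ihom A₁).obj B₁}
    {q : Q ⟶ (ihom B).obj E} {h : Q ⟶ (ihom B₁).obj E₁} {r : R ⟶ (ihom A).obj E}
    {i : R ⟶ (ihom A₁).obj E₁} (hg : Represents a b p g) (hc : Mono c) (hh : Represents b c q h)
    (hi : Represents a c r i) {m : P ⊗ Q ⟶ R}
    (hm : m ≫ r = (p ⊗ₘ q) ≫ MonoidalClosed.comp A B E) :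
    m ≫ i = (g ⊗ₘ h) ≫ MonoidalClosed.comp A₁ B₁ E₁ := by
  apply hom_ext_of_mono c
  -- Evaluating the composite represented by `r` is two successive evaluations.
  have hr : A₁ ◁ m ≫ (a ⊗ₘ r) ≫ evl A E =
      (α_ _ _ _).inv ≫ ((a ⊗ₘ p) ≫ evl A B ⊗ₘ q) ≫ evl B E := by
    rw [← MonoidalCategory.id_tensorHom, tensorHom_comp_tensorHom_assoc, hm, Category.id_comp,
      ← Category.comp_id a, ← tensorHom_comp_tensorHom_assoc, MonoidalCategory.id_tensorHom,
      comp_ev, associator_inv_naturality_assoc, ← MonoidalCategory.tensorHom_id,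
      tensorHom_comp_tensorHom_assoc, Category.comp_id, Category.comp_id]
  rw [MonoidalCategory.whiskerLeft_comp_assoc, hi, hr, ← hg,
    MonoidalCategory.whiskerLeft_comp_assoc, reassoc_of% comp_ev A₁ B₁ E₁,
    ← MonoidalCategory.id_tensorHom A₁ (g ⊗ₘ h), associator_inv_naturality_assoc,
    ← MonoidalCategory.tensorHom_id (evl A₁ B₁), tensorHom_comp_tensorHom_assoc,
    Category.comp_id, MonoidalCategory.id_tensorHom, MonoidalCategory.tensorHom_def (_ ≫ _) h,
    Category.assoc, hh, ← MonoidalCategory.tensorHom_id, tensorHom_comp_tensorHom_assoc,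
    Category.id_comp, Category.assoc]

/-- Followed by `e'`, both sides evaluate `p` and `q` side by side on the images under `a` and `b`.
The maps `n` and `n'` play the tensor comparisons on inputs and outputs. -/
theorem Represents.tens {E'₁ : D} {p : P ⟶ (ihom A).obj A'} {g : P ⟶ (ihom A₁).obj A'₁}
    {q : Q ⟶ (ihom B).obj B'} {h : Q ⟶ (ihom B₁).obj B'₁} {e : E₁ ⟶ A ⊗ B} {e' : E'₁ ⟶ A' ⊗ B'}
    {r : R ⟶ (ihom (A ⊗ B)).obj (A' ⊗ B')}
    {i : R ⟶ (ihom E₁).obj E'₁} (hg : Represents a a' p g) (he' : Mono e') (hh : Represents b b' q h)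
    (hi : Represents e e' r i) {m : P ⊗ Q ⟶ R}
    (hm : m ≫ r = (p ⊗ₘ q) ≫ tens A A' B B') {n : A₁ ⊗ B₁ ⟶ E₁} (hn : n ≫ e = a ⊗ₘ b)
    {n' : A'₁ ⊗ B'₁ ⟶ E'₁} (hn' : n' ≫ e' = a' ⊗ₘ b') :
    (g ⊗ₘ h) ≫ HigherOrder.tens A₁ A'₁ B₁ B'₁ ≫ (ihom (A₁ ⊗ B₁)).map n' =
      m ≫ i ≫ (pre n).app E'₁ := by
  apply hom_ext_of_mono e'
  rw [MonoidalCategory.whiskerLeft_comp_assoc, MonoidalCategory.whiskerLeft_comp_assoc,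
    reassoc_of% map_ev n', hn', reassoc_of% tens_ev, tensorHom_comp_tensorHom,
    tensorμ_natural_right_assoc, tensorHom_comp_tensorHom, hg, hh,
    MonoidalCategory.whiskerLeft_comp_assoc, MonoidalCategory.whiskerLeft_comp_assoc,
    reassoc_of% pre_ev n, whisker_exchange_assoc, whisker_exchange_assoc, hi,
    ← MonoidalCategory.tensorHom_def_assoc, tensorHom_comp_tensorHom_assoc, hm, hn,
    ← Category.comp_id (a ⊗ₘ b), ← tensorHom_comp_tensorHom_assoc (a ⊗ₘ b),
    MonoidalCategory.id_tensorHom, tens_ev, tensorμ_natural_assoc, tensorHom_comp_tensorHom]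

end Represents

/-! ### Raising functors and `γ` between subcategories related by internal homs. -/

namespace SubSMC
variable {D : Type u} [Category.{v} D] [MonoidalCategory D] [SymmetricCategory D]
  [MonoidalClosed D] {S T W : SubSMC D}

section
variable (h : ∀ A B : D, S.P A → S.P B → T.P ((ihom A).obj B))

/-- The canonical morphism `[I, A] ⟶ A`. -/
def raiseLower (A : S.Cat) :
    letI := enrichedSMC h
    obj ((raise T.Cat S.Cat).obj A) ⟶ obj A :=
  lower S.unitIso (obj A)

instance (A : S.Cat) : IsIso (raiseLower h A) := isIso_lower _ _

/-- With `dn_raiseUnit_lower` and `dn_raiseTensor_lower`, this supplies the hypotheses `hl`, `hr`,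
`hm` of `exists_braided`. -/
theorem dn_raise_map_lower {A B : S.Cat} (f : A ⟶ B) :
    letI := enrichedSMC h
    dn ((raise T.Cat S.Cat).map f) ≫ raiseLower h B = raiseLower h A ≫ dn f := by
  let _ := enrichedSMC h
  exact (congrArg (· ≫ lower S.unitIso (obj B)) (dn_eHomWhiskerLeft h (𝟙_ S.Cat) f)).trans
    (ihom_map_lower S.unitIso (dn f))

theorem dn_raiseUnit_lower :
    letI := enrichedSMC h
    dn (raiseUnit T.Cat S.Cat) ≫ raiseLower h (𝟙_ S.Cat) =
      T.objUnitIso.hom ≫ S.objUnitIso.inv := by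
  change (T.unitIso.hom ≫ MonoidalClosed.curry' (𝟙 S.unit)) ≫ lower S.unitIso S.unit =
    T.unitIso.hom ≫ S.unitIso.inv
  rw [Category.assoc, curry'_lower, Category.comp_id]

theorem dn_raiseTensor_lower (A B : S.Cat) :
    letI := enrichedSMC h
    dn (raiseTensor T.Cat S.Cat A B) ≫ raiseLower h (A ⊗ B) =
      raiseLower h A ⊗ₘ raiseLower h B := by
  let _ := enrichedSMC h
  have e : dn (raiseTensor T.Cat S.Cat A B) = tens S.unit (obj A) S.unit (obj B) ≫
      (MonoidalClosed.pre ((λ_ S.unit).inv ≫ S.unitIso.inv ▷ S.unit)).app (obj A ⊗ obj B) :=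
    congrArg (tens S.unit (obj A) S.unit (obj B) ≫ ·)
      (dn_eHomWhiskerRight h (λ_ (𝟙_ S.Cat)).inv (A ⊗ B))
  exact (congrArg (· ≫ lower S.unitIso (obj A ⊗ obj B)) e).trans
    ((Category.assoc _ _ _).trans (tens_lower S.unitIso (obj A) (obj B)))

theorem exists_isRaising :
    letI := enrichedSMC h
    ∃ F : (raise T.Cat S.Cat).Braided, IsRaising T.Cat S.Cat F := by
  let _ := enrichedSMC h
  obtain ⟨F, hε, hμ⟩ := exists_braided (raise T.Cat S.Cat) (raiseLower h)
    (dn_raise_map_lower h) (raiseUnit T.Cat S.Cat) (dn_raiseUnit_lower h)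
    (raiseTensor T.Cat S.Cat) (dn_raiseTensor_lower h)
  exact ⟨F, hε, hμ⟩

variable (h' : ∀ A B : D, T.P A → T.P B → W.P ((ihom A).obj B))

/-- The precise sense in which `γ` is the identity of `[A, B]`: it represents the lowering `[I, [A,
B]] ⟶ [A, B]`. -/
theorem represents_gamma (A B : S.Cat) :
    letI := enrichedSMC h
    letI := enrichedSMC h'
    Represents (A := obj A) (B := obj B) (A₁ := obj (𝟙_ S.Cat ⟶[T.Cat] A))
      (B₁ := obj (𝟙_ S.Cat ⟶[T.Cat] B)) (raiseLower h A) (raiseLower h B)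
      (raiseLower h' (A ⟶[T.Cat] B)) (dn (gamma W.Cat T.Cat A B)) := by
  let _ := enrichedSMC h
  let _ := enrichedSMC h'
  have e : dn (gamma W.Cat T.Cat A B) =
      ((λ_ _).inv ≫ MonoidalClosed.curry' (𝟙 ((ihom S.unit).obj (obj A))) ▷ _ ≫
        tens ((ihom S.unit).obj (obj A)) ((ihom S.unit).obj (obj A)) T.unit
          ((ihom (obj A)).obj (obj B))) ≫
      (ihom _).map (MonoidalClosed.comp S.unit (obj A) (obj B)) ≫
        (MonoidalClosed.pre ((ρ_ _).inv ≫ _ ◁ T.unitIso.inv)).app _ := by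
    -- The function spells out `γ` in `D`, where it unfolds definitionally up to its last factor
    -- `z`; that factor is rewritten as a precomposition.
    exact (congrArg (fun z => ((ρ_ _).inv ≫ _ ◁ W.unitIso.inv) ≫
      _ ◁ (W.unitIso.hom ≫ MonoidalClosed.curry' (MonoidalClosed.comp S.unit (obj A) (obj B))) ≫
      (((((λ_ _).inv ≫ W.unitIso.inv ▷ _) ≫
        (W.unitIso.hom ≫ MonoidalClosed.curry' (𝟙 ((ihom S.unit).obj (obj A)))) ▷ _ ≫
        tens ((ihom S.unit).obj (obj A)) ((ihom S.unit).obj (obj A)) T.unit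
          ((ihom (obj A)).obj (obj B)))) ▷ _ ≫ MonoidalClosed.comp _ _ _) ≫ z)
      (dn_eHomWhiskerRight h' (ρ_ (𝟙_ S.Cat ⟶[T.Cat] A)).inv (𝟙_ S.Cat ⟶[T.Cat] B))).trans
        (insertion_eq W.unitIso _ _)
  rw [e]
  exact insertion_lower S.unitIso T.unitIso (obj A) (obj B)

theorem exists_isGamma :
    letI := enrichedSMC h
    letI := enrichedSMC h'
    ∃ Γ : PMFunctor (raise W.Cat T.Cat) (raise T.Cat S.Cat), IsGamma Γ := by
  let _ := enrichedSMC h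
  let _ := enrichedSMC h'
  obtain ⟨F, hF⟩ := exists_isRaising h
  obtain ⟨G, hG⟩ := exists_isRaising h'
  refine ⟨
    { braidedV := G
      braidedC := F
      map A B := gamma W.Cat T.Cat A B
      map_state {A B} f := ?_
      map_comp A B E := ?_
      map_tensor A A' B B' := ?_ }, hG, hF, fun _ _ => rfl⟩
  · rw [hG.unit_eq]
    -- The raised state of `f` lowers to the transpose of `f`: the unit isomorphism of `T` inside
    -- `eHomEquiv T.Cat f` cancels against the one left by the unit comparison.
    have hs : (dn (raiseUnit W.Cat T.Cat) ≫ dn ((raise W.Cat T.Cat).map (eHomEquiv T.Cat f))) ≫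
        raiseLower h' (A ⟶[T.Cat] B) =
        W.objUnitIso.hom ≫ MonoidalClosed.curry' (dn f) := by
      rw [Category.assoc, dn_raise_map_lower h', reassoc_of% dn_raiseUnit_lower h']
      exact congrArg (W.objUnitIso.hom ≫ ·) (T.unitIso.inv_hom_id_assoc _)
    exact hom_ext (((represents_gamma h h' A B).state
      (IsIso.mono_of_iso (raiseLower h B)) (dn_raise_map_lower h f) hs).trans
      (Category.assoc _ _ _))
  · rw [hG.tensor_eq]
    -- The raised composition morphism lowers to composition in `D`.
    have hm : (dn (raiseTensor W.Cat T.Cat (A ⟶[T.Cat] B) (B ⟶[T.Cat] E)) ≫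
        dn ((raise W.Cat T.Cat).map (eComp T.Cat A B E))) ≫ raiseLower h' (A ⟶[T.Cat] E) =
        (raiseLower h' (A ⟶[T.Cat] B) ⊗ₘ raiseLower h' (B ⟶[T.Cat] E)) ≫
          MonoidalClosed.comp (obj A) (obj B) (obj E) := by
      rw [Category.assoc, dn_raise_map_lower h', reassoc_of% dn_raiseTensor_lower h']
      rfl
    exact hom_ext ((Category.assoc _ _ _).symm.trans
      ((represents_gamma h h' A B).comp (IsIso.mono_of_iso (raiseLower h E))
        (represents_gamma h h' B E) (represents_gamma h h' A E) hm))
  · rw [hG.tensor_eq, hF.tensor_eq, hF.tensor_eq]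
    have hm : (dn (raiseTensor W.Cat T.Cat (A ⟶[T.Cat] A') (B ⟶[T.Cat] B')) ≫
        dn ((raise W.Cat T.Cat).map (EnrichedSMC.eTensor A A' B B'))) ≫
          raiseLower h' ((A ⊗ B) ⟶[T.Cat] (A' ⊗ B')) =
        (raiseLower h' (A ⟶[T.Cat] A') ⊗ₘ raiseLower h' (B ⟶[T.Cat] B')) ≫
          tens (obj A) (obj A') (obj B) (obj B') := by
      rw [Category.assoc, dn_raise_map_lower h', reassoc_of% dn_raiseTensor_lower h']
      rfl
    -- The tensor comparisons of the raising functor of `S` serve as `n` and `n'`.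
    have key := (represents_gamma h h' A A').tens
      (IsIso.mono_of_iso (raiseLower h (A' ⊗ B'))) (represents_gamma h h' B B')
      (represents_gamma h h' (A ⊗ B) (A' ⊗ B')) hm (dn_raiseTensor_lower h A B)
      (dn_raiseTensor_lower h A' B')
    refine hom_ext ?_
    simp only [dn_comp, dn_eHomWhiskerLeft h', dn_eHomWhiskerRight h']
    exact key.trans (Category.assoc _ _ _)

end
end SubSMC
end HigherOrder

/-! ### The layers of `Caus O`. -/

theorem mainTheorem4 (C : Type u) [Category.{v} C] [MonoidalCategory C] [SymmetricCategory C]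
    [LeftRigidCategory C] [PrecausalCategory C] :
    (∀ n : ℕ, ∃ Γ : PMFunctor
        (raise (Layer (HomOrder.discrete C) (n + 2)) (Layer (HomOrder.discrete C) (n + 1)))
        (raise (Layer (HomOrder.discrete C) (n + 1)) (Layer (HomOrder.discrete C) n)),
      IsGamma Γ) ∧
    ∀ (O : HomOrder C) (n : ℕ), ∃ Γ : PMFunctor
        (raise (Layer O (n + 2)) (Layer O (n + 1))) (raise (Layer O (n + 1)) (Layer O n)),
      IsGamma Γ := by
  have key (O : HomOrder C) (n : ℕ) : ∃ Γ : PMFunctor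
      (raise (Layer O (n + 2)) (Layer O (n + 1))) (raise (Layer O (n + 1)) (Layer O n)),
      IsGamma Γ :=
    -- Layers are indexed from zero, so `n` stands for `i = n + 1`. Internal homs of one layer are
    -- generators of the next, which gives both closure hypotheses.
    SubSMC.exists_isGamma (S := layer O n) (T := layer O (n + 1)) (W := layer O (n + 2))
      (fun _ _ => HomClosure.hom) (fun _ _ => HomClosure.hom)
  exact ⟨key _, key⟩
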